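/- Let $X=\{0,1,2\}=\mathbb Z/3\mathbb Z$, and let $X^*$ be the ternary rooted tree of finite words over $X$ (the root is the empty word, and the tree order is the prefix order). For tree automorphisms $f_0,f_1,f_2$ and $\sigma\in\mathrm{Sym}(X)$ let $\langle\langle f_0,f_1,f_2\rangle\rangle\sigma$ be the automorphism $xw\mapsto \sigma(x)\,f_x(w)$ ($x\in X$, $w\in X^*$). Let $a$ be the automorphism $xw\mapsto (x+1)w$, which permutes the three subtrees below the root cyclically, and let $t$ be the automorphism defined recursively by $t=\langle\langle a,1,t\rangle\rangle$, that is, $t(0w)=0\,a(w)$, $t(1w)=1w$, $t(2w)=2\,t(w)$. The Fabrykowski-Gupta group is $G=\langle a,t\rangle\le \mathrm{Aut}(X^*)$. For $n\ge 0$ let $\gamma(n)$ be the number of elements of $G$ that can be written as a product of at most $n$ factors from $\{a,a^{-1},t,t^{-1}\}$. For functions $f,g$ on the natural numbers write $f\lesssim g$ if there is an integer $A>0$ such that $f(n)\le g(An)$ for all $n\ge 1$. Theorem. The growth of $G$ is intermediate: $n^d=o(\gamma(n))$ for every $d\in\mathbb N$, and $\gamma(n)=o(c^n)$ for every real $c>1$.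 More precisely, $$ e^{\,n^{\frac{\log 3}{\log 6}}}\;\lesssim\;\gamma(n)\;\lesssim\; e^{\frac{n(\log\log n)^2}{\log n}} . $$ -/

import Mathlib

open scoped Asymptotics

namespace FabrykowskiGupta

/-- The vertices of the ternary rooted tree: finite words over `{0, 1, 2} = ℤ/3ℤ`.
The root is the empty word, and `u` lies on the path from the root to `v` iff `u` is a prefix
of `v`. -/
abbrev Vertex : Type := List (ZMod 3)

/-- The automorphism group of the ternary rooted tree: the bijections of the vertex set that
preserve and reflect the prefix relation, under composition. -/
abbrev TreeAut : Type :=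
  ((fun u v : Vertex => u <+: v) ≃r (fun u v : Vertex => u <+: v))

/-- The action of `⟨f 0, f 1, f 2⟩ σ` on vertices. -/
def nodeFun (f : ZMod 3 → Vertex → Vertex) (σ : ZMod 3 → ZMod 3) : Vertex → Vertex
  | [] => []
  | x :: w => σ x :: f x w

/-- The automorphism `⟨f 0, f 1, f 2⟩ σ`, sending the word `x w` to `σ(x) f_x(w)`. -/
def node (f : ZMod 3 → TreeAut) (σ : Equiv.Perm (ZMod 3)) : TreeAut where
  toFun := nodeFun (fun x => f x) σ
  invFun := nodeFun (fun y => (f (σ.symm y)).symm) σ.symm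
  left_inv := by
    rintro (_ | ⟨x, w⟩) <;> simp [nodeFun]
  right_inv := by
    rintro (_ | ⟨x, w⟩) <;> simp [nodeFun]
  map_rel_iff' := by
    rintro (_ | ⟨x, u⟩) (_ | ⟨y, v⟩)
    · simp [nodeFun]
    · simp [nodeFun]
    · simp [nodeFun]
    · simp only [Equiv.coe_fn_mk, nodeFun, List.cons_prefix_cons, EmbeddingLike.apply_eq_iff_eq]
      constructor
      · rintro ⟨rfl, h⟩
        exact ⟨rfl, (f x).map_rel_iff.1 h⟩
      · rintro ⟨rfl, h⟩
        exact ⟨rfl, (f x).map_rel_iff.2 h⟩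

/-- The automorphism `a`, which permutes the three subtrees below the root cyclically. -/
def a : TreeAut := node (fun _ => 1) (Equiv.addRight 1)

/-- The action on vertices of `t = ⟨a, 1, t⟩`. -/
def tFun : Vertex → Vertex
  | [] => []
  | x :: w => x :: (if x = 0 then a w else if x = 1 then w else tFun w)

/-- The action on vertices of the inverse of `t`. -/
def tInvFun : Vertex → Vertex
  | [] => []
  | x :: w => x :: (if x = 0 then a.symm w else if x = 1 then w else tInvFun w)

/-- The automorphism `t = ⟨a, 1, t⟩`; see `t_eq`. -/
def t : TreeAut where
  toFun := tFun
  invFun := tInvFun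
  left_inv := by
    intro w
    induction w with
    | nil => rfl
    | cons x w ih =>
      simp only [tFun, tInvFun]
      split_ifs <;> simp [ih]
  right_inv := by
    intro w
    induction w with
    | nil => rfl
    | cons x w ih =>
      simp only [tFun, tInvFun]
      split_ifs <;> simp [ih]
  map_rel_iff' := by
    intro u
    induction u with
    | nil => intro v; simp [tFun]
    | cons x u ih =>
      rintro (_ | ⟨y, v⟩)
      · simp [tFun]
      · simp only [Equiv.coe_fn_mk, tFun, List.cons_prefix_cons]
        refine and_congr_right ?_
        rintro rfl
        split_ifs
        · exact a.map_rel_iff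
        · exact Iff.rfl
        · exact ih

/-- The recursion that defines `t`. -/
theorem t_eq : t = node ![a, 1, t] 1 := by
  apply RelIso.ext
  rintro (_ | ⟨x, w⟩)
  · rfl
  · have h : t (x :: w) = tFun (x :: w) := rfl
    rw [h]
    change _ = x :: ((![a, 1, t] : ZMod 3 → TreeAut) x) w
    fin_cases x <;> rfl

/-- The Fabrykowski-Gupta group `G = ⟨a, t⟩`. -/
def fabrykowskiGupta : Subgroup TreeAut := Subgroup.closure {a, t}

/-- The two standard generators `a` and `t`, as elements of the Fabrykowski-Gupta group. -/
def generators : Set fabrykowskiGupta := {g | (g : TreeAut) = a ∨ (g : TreeAut) = t}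

/-- The ball of radius `n`: the elements of the group that can be written as a product of at most
`n` factors, each of which is an element of `S` or the inverse of one. -/
def ball {Γ : Type*} [Group Γ] (S : Set Γ) (n : ℕ) : Set Γ :=
  {g | ∃ l : List Γ, l.length ≤ n ∧ (∀ s ∈ l, s ∈ S ∨ s⁻¹ ∈ S) ∧ l.prod = g}

/-- Balls of a finite set are finite, so that `Set.ncard` below counts their elements. -/
theorem ball_finite {Γ : Type*} [Group Γ] {S : Set Γ} (hS : S.Finite) (n : ℕ) :
    (ball S n).Finite := by
  have hT : (S ∪ S⁻¹).Finite := hS.union hS.inv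
  have : Finite (S ∪ S⁻¹ : Set Γ) := hT
  refine ((List.finite_length_le (S ∪ S⁻¹ : Set Γ) n).image
    (fun l => (l.map Subtype.val).prod)).subset ?_
  rintro g ⟨l, hl, hs, rfl⟩
  refine ⟨l.attach.map (fun s => ⟨s.1, by simpa using hs s.1 s.2⟩), by simpa using hl, ?_⟩
  simp [List.map_map, Function.comp_def]

theorem generators_finite : generators.Finite := by
  have h : (Subtype.val ⁻¹' ({a, t} : Set TreeAut) : Set fabrykowskiGupta).Finite :=
    Set.Finite.preimage Subtype.val_injective.injOn (Set.toFinite _)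
  exact h.subset fun g hg => hg

/-- The growth function of a group with respect to `S`: the number of elements that are products
of at most `n` elements of `S` and their inverses. -/
noncomputable def growth {Γ : Type*} [Group Γ] (S : Set Γ) (n : ℕ) : ℕ := (ball S n).ncard

/-- The relation `f ≲ g`: there is a constant `A > 0` with `f(n) ≤ g(A n)` for all `n ≥ 1`. -/
def Dominated (f g : ℕ → ℝ) : Prop :=
  ∃ A : ℕ, 0 < A ∧ ∀ n : ℕ, 1 ≤ n → f n ≤ g (A * n)

/-- A growth function is intermediate if it grows faster than every polynomial and slower than
every exponential function. -/
def IsIntermediate (γ : ℕ → ℝ) : Prop :=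
  (∀ d : ℕ, (fun n : ℕ => (n : ℝ) ^ d) =o[Filter.atTop] γ) ∧
    ∀ c : ℝ, 1 < c → γ =o[Filter.atTop] (fun n : ℕ => c ^ n)

end FabrykowskiGupta

/-!
The lower bound comes from the substitution `a ↦ a⁻¹ t a`, `t ↦ t`. It turns a word for an element
`g` of the commutator subgroup into a word, at most twice as long, for the element whose sections are
`1`, `1`, `g` (`IsWord.substitution`). Conjugation by `a` moves `g` to the other two vertices, so any
three elements of the commutator subgroup are the sections of a fourth one that is six times as long
up to an additive constant (`nodeHom_mem_derivedBall`). Thus multiplying the radius by `6` raises the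
number of elements to the third power, which gives the exponent `log 3 / log 6`.

For the upper bound, length is counted in powers of `t` alone. Because `t = ⟨a, 1, t⟩`, the total
length of the sections of `g` is at most the length of `g`, on the first level and hence on the
second. Write `g`, up to powers of `a`, as a word in letters `t^{±1} a^{±1}`. The second level loses
length at certain windows of seven letters (`Bad`): at a turn `t^x a t^y a⁻¹ t^z`, since the outer
powers of `t` merge in one section, and at windows for which a section has such a turn. A word without
such windows is almost periodic: the exponents of `a` change sign at most once, and in each residue
class modulo `3` the exponents of `t` change sign only boundedly often. In general, the number of
letters not predicted by the recursion `d j = d (j + 1)`, `e j = e (j + 3)` is linear in the number of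
bad windows (`surprises_le`), which in turn is at most seven times the loss of length
(`exists_val_mem_liftLift`). So an element of length at most `n` either loses a proportion `2 / q` of
its length `n`, or is one of at most `exp (C n log q / q)` elements up to polynomial factors.

If the ball of radius `n` has at most `exp (α n + β)` elements for all `n`, then elements of the first
kind number at most `exp (α (1 - 2 / q) n + 9 β)` up to polynomial factors, since an element is
determined by its nine sections on the second level. The rates `α = 501 log k / k` with `q = k + 1`
pass through this recursion, with `β` growing like `18 ^ k` (`ncard_tBall_le_exp`). Taking `k` close
to `log n / 6` bounds the logarithm of the growth function by a multiple of `n log log n / log n`.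
-/

namespace FabrykowskiGupta

/-! ### Decomposition of tree automorphisms -/

theorem node_apply_cons (f : ZMod 3 → TreeAut) (σ : Equiv.Perm (ZMod 3)) (x : ZMod 3)
    (w : Vertex) : node f σ (x :: w) = σ x :: f x w := rfl

theorem node_mul (f g : ZMod 3 → TreeAut) (σ τ : Equiv.Perm (ZMod 3)) :
    node f σ * node g τ = node (fun x => f (τ x) * g x) (σ * τ) := by
  apply RelIso.ext
  rintro (_ | ⟨x, w⟩) <;> rfl

theorem node_injective {f g : ZMod 3 → TreeAut} {σ τ : Equiv.Perm (ZMod 3)}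
    (h : node f σ = node g τ) : f = g := by
  funext x
  apply RelIso.ext
  intro w
  have := congrArg (fun k : TreeAut => k (x :: w)) h
  simp only [node_apply_cons, List.cons.injEq] at this
  exact this.2

/-- The stabilizer of the first level, identified with the triples of tree automorphisms. -/
def nodeHom : (ZMod 3 → TreeAut) →* TreeAut where
  toFun f := node f 1
  map_one' := by
    apply RelIso.ext
    rintro (_ | ⟨x, w⟩) <;> rfl
  map_mul' f g := by
    rw [node_mul]
    rfl

theorem nodeHom_apply (f : ZMod 3 → TreeAut) : nodeHom f = node f 1 := rfl

theorem nodeHom_injective : Function.Injective nodeHom := fun _ _ h => node_injective h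

/-- The triple with components `x`, `y`, `z` at the vertices `0`, `1`, `2`. -/
def triple (x y z : TreeAut) : ZMod 3 → TreeAut := ![x, y, z]

theorem triple_mul (x y z x' y' z' : TreeAut) :
    triple x y z * triple x' y' z' = triple (x * x') (y * y') (z * z') := by
  funext i
  fin_cases i <;> rfl

theorem triple_zpow (x y z : TreeAut) (n : ℤ) :
    triple x y z ^ n = triple (x ^ n) (y ^ n) (z ^ n) := by
  funext i
  fin_cases i <;> rfl

theorem triple_one : triple 1 1 1 = 1 := by
  funext i
  fin_cases i <;> rfl

theorem a_pow_three : a ^ 3 = 1 := by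
  apply RelIso.ext
  rintro (_ | ⟨x, w⟩)
  · rfl
  · change (x + 1 + 1 + 1) :: w = x :: w
    congr 1
    revert x
    decide

theorem t_zpow (z : ℤ) : t ^ z = nodeHom (triple (a ^ z) 1 (t ^ z)) := by
  have h : t = nodeHom (triple a 1 t) := t_eq
  conv_lhs => rw [h, ← map_zpow, triple_zpow, one_zpow]

theorem t_pow_three : t ^ 3 = 1 := by
  apply RelIso.ext
  intro w
  induction w with
  | nil => rfl
  | cons x w ih =>
    have h3 := t_zpow 3
    norm_cast at h3
    rw [a_pow_three] at h3
    rw [h3]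
    change x :: triple 1 1 (t ^ 3) x w = x :: w
    congr 1
    fin_cases x
    · rfl
    · rfl
    · exact ih

theorem a_mul_nodeHom (x y z : TreeAut) : a * nodeHom (triple x y z) = nodeHom (triple z x y) * a := by
  rw [nodeHom_apply, nodeHom_apply, a, node_mul, node_mul]
  congr 1
  funext i
  fin_cases i
  · exact (one_mul _).trans (mul_one _).symm
  · exact (one_mul _).trans (mul_one _).symm
  · exact (one_mul _).trans (mul_one _).symm

theorem a_inv_mul_nodeHom (x y z : TreeAut) :
    a⁻¹ * nodeHom (triple x y z) = nodeHom (triple y z x) * a⁻¹ := by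
  rw [inv_mul_eq_iff_eq_mul, ← mul_assoc, a_mul_nodeHom, mul_assoc, mul_inv_cancel, mul_one]

/-! ### Products with a bounded number of powers of `t` -/

/-- `IsTProd n g`: the automorphism `g` is a product of powers of `a` and of `t` in which at most
`n` factors are powers of `t`. -/
inductive IsTProd : ℕ → TreeAut → Prop
  | one (n : ℕ) : IsTProd n 1
  | a_mul {n : ℕ} {g : TreeAut} (z : ℤ) (h : IsTProd n g) : IsTProd n (a ^ z * g)
  | t_mul {n : ℕ} {g : TreeAut} (z : ℤ) (h : IsTProd n g) : IsTProd (n + 1) (t ^ z * g)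

/-- The set of all products of powers of `a` and `t` with at most `n` powers of `t`. -/
def tBall (n : ℕ) : Set TreeAut := {g | IsTProd n g}

/-- A filtration of the tree automorphisms that is compatible with products and whose zeroth term
contains the powers of `a`. -/
structure IsLength (P : ℕ → Set TreeAut) : Prop where
  mono : Monotone P
  a_mem : ∀ z : ℤ, a ^ z ∈ P 0
  mul_mem : ∀ {m n : ℕ} {g h : TreeAut}, g ∈ P m → h ∈ P n → g * h ∈ P (m + n)

theorem IsLength.one_mem {P : ℕ → Set TreeAut} (hP : IsLength P) : 1 ∈ P 0 := by
  simpa using hP.a_mem 0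

theorem monotone_tBall : Monotone tBall := by
  refine monotone_nat_of_le_succ fun n g h => ?_
  induction h with
  | one n => exact .one _
  | a_mul z _ ih => exact .a_mul z ih
  | t_mul z _ ih => exact .t_mul z ih

theorem isLength_tBall : IsLength tBall where
  mono := monotone_tBall
  a_mem z := by
    have := IsTProd.a_mul z (IsTProd.one 0)
    rwa [mul_one] at this
  mul_mem := by
    intro m n g h hg hh
    induction hg with
    | one k =>
      rw [one_mul]
      exact monotone_tBall (Nat.le_add_left n k) hh
    | a_mul z _ ih =>
      rw [mul_assoc]
      exact .a_mul z ih
    | t_mul z _ ih =>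
      rw [mul_assoc, Nat.add_right_comm]
      exact .t_mul z ih

theorem t_zpow_mem_tBall (z : ℤ) : t ^ z ∈ tBall 1 := by
  have := IsTProd.t_mul z (IsTProd.one 0)
  rwa [mul_one] at this

/-- The filtration that measures an automorphism by the sum of the lengths of its three sections,
where only cyclic permutations of the first level are allowed. -/
def lift (P : ℕ → Set TreeAut) (n : ℕ) : Set TreeAut :=
  {g | ∃ (f : ZMod 3 → TreeAut) (s : ZMod 3) (k : ZMod 3 → ℕ),
    g = node f (Equiv.addRight s) ∧ (∀ x, f x ∈ P (k x)) ∧ ∑ x, k x ≤ n}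

theorem nodeHom_mem_lift {P : ℕ → Set TreeAut} {x y z : TreeAut} {i j k n : ℕ}
    (hx : x ∈ P i) (hy : y ∈ P j) (hz : z ∈ P k) (hn : i + j + k ≤ n) :
    nodeHom (triple x y z) ∈ lift P n := by
  refine ⟨![x, y, z], 0, ![i, j, k], ?_, ?_, ?_⟩
  · rw [nodeHom_apply]
    congr 1
    ext w
    simp
  · intro w
    fin_cases w
    exacts [hx, hy, hz]
  · refine le_trans (le_of_eq ?_) hn
    exact Fin.sum_univ_three _

theorem IsLength.lift {P : ℕ → Set TreeAut} (hP : IsLength P) : IsLength (lift P) := by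
  have hmul : ∀ {m n : ℕ} {g h : TreeAut}, g ∈ FabrykowskiGupta.lift P m →
      h ∈ FabrykowskiGupta.lift P n → g * h ∈ FabrykowskiGupta.lift P (m + n) := by
    rintro m n _ _ ⟨f, s, k, rfl, hf, hk⟩ ⟨f', s', k', rfl, hf', hk'⟩
    refine ⟨fun x => f (x + s') * f' x, s' + s, fun x => k (x + s') + k' x, ?_,
      fun x => hP.mul_mem (hf _) (hf' _), ?_⟩
    · rw [node_mul]
      congr 1
      ext x
      simp [add_assoc]
    · rw [Finset.sum_add_distrib]
      refine add_le_add (le_trans (le_of_eq ?_) hk) hk'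
      exact Equiv.sum_comp (Equiv.addRight s') k
  have ha : ∀ e : ℤ, (e = 1 ∨ e = -1) → a ^ e ∈ FabrykowskiGupta.lift P 0 := by
    rintro e (rfl | rfl)
    · rw [zpow_one]
      exact ⟨fun _ => 1, 1, fun _ => 0, rfl, fun _ => hP.one_mem, by simp⟩
    · refine ⟨fun _ => 1, -1, fun _ => 0, ?_, fun _ => hP.one_mem, by simp⟩
      rw [zpow_neg, zpow_one, inv_eq_iff_mul_eq_one, a, node_mul]
      have : (Equiv.addRight 1 * Equiv.addRight (-1) : Equiv.Perm (ZMod 3)) = 1 := by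
        ext x
        simp
      rw [this]
      simp only [mul_one]
      exact map_one nodeHom
  refine ⟨?_, fun z => ?_, hmul⟩
  · rintro m n hmn _ ⟨f, s, k, h1, h2, h3⟩
    exact ⟨f, s, k, h1, h2, h3.trans hmn⟩
  · induction z using Int.induction_on with
    | zero =>
      simpa using hmul (ha 1 (.inl rfl)) (ha (-1) (.inr rfl))
    | succ i ih =>
      rw [zpow_add]
      exact hmul ih (ha 1 (.inl rfl))
    | pred i ih =>
      rw [sub_eq_add_neg, zpow_add]
      exact hmul ih (ha (-1) (.inr rfl))

theorem lift_mono {P Q : ℕ → Set TreeAut} (h : ∀ n, P n ⊆ Q n) (n : ℕ) : lift P n ⊆ lift Q n := by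
  rintro _ ⟨f, s, k, h1, h2, h3⟩
  exact ⟨f, s, k, h1, fun x => h _ (h2 x), h3⟩

/-- The sections of an automorphism have total length at most its length, since
`t = ⟨a, 1, t⟩`. -/
theorem tBall_subset_lift (n : ℕ) : tBall n ⊆ lift tBall n := by
  have hL := isLength_tBall.lift
  intro g hg
  induction hg with
  | one n => exact hL.mono (Nat.zero_le n) hL.one_mem
  | @a_mul n g z _ ih =>
    have := hL.mul_mem (hL.a_mem z) ih
    rwa [zero_add] at this
  | @t_mul n g z _ ih =>
    have h1 : t ^ z ∈ lift tBall 1 := by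
      rw [t_zpow]
      exact nodeHom_mem_lift (isLength_tBall.a_mem z) isLength_tBall.one_mem
        (t_zpow_mem_tBall z) le_rfl
    have := hL.mul_mem h1 ih
    rwa [add_comm] at this

theorem tBall_subset_lift_lift (n : ℕ) : tBall n ⊆ lift (lift tBall) n :=
  (tBall_subset_lift n).trans (lift_mono tBall_subset_lift n)

/-! ### Words in the letters `t^{±1} a^{±1}` -/

/-- The sign `1` or `-1` encoded by a Boolean. -/
def sgn (b : Bool) : ℤ := if b then 1 else -1

/-- The value of a word, in which the letter `(e, d)` stands for `t ^ sgn e * a ^ sgn d`. -/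
def val : List (Bool × Bool) → TreeAut
  | [] => 1
  | x :: l => t ^ sgn x.1 * (a ^ sgn x.2 * val l)

theorem zpow_eq_of_pow_three {g : TreeAut} (h : g ^ 3 = 1) (z : ℤ) :
    g ^ z = 1 ∨ ∃ b, g ^ z = g ^ sgn b := by
  have h3 : g ^ (3 : ℤ) = 1 := by exact_mod_cast h
  have key : ∀ r : ℤ, (∃ c, z = 3 * c + r) → g ^ z = g ^ r := by
    rintro r ⟨c, rfl⟩
    rw [zpow_add, zpow_mul, h3, one_zpow, one_mul]
  have hcases : (∃ c, z = 3 * c + 0) ∨ (∃ c, z = 3 * c + 1) ∨ ∃ c, z = 3 * c + -1 := by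
    rcases (by omega : z % 3 = 0 ∨ z % 3 = 1 ∨ z % 3 = 2) with h | h | h
    · exact .inl ⟨z / 3, by omega⟩
    · exact .inr (.inl ⟨z / 3, by omega⟩)
    · exact .inr (.inr ⟨z / 3 + 1, by omega⟩)
  rcases hcases with h | h | h
  · left
    rw [key 0 h, zpow_zero]
  · exact .inr ⟨true, key 1 h⟩
  · exact .inr ⟨false, key (-1) h⟩

/-- Up to powers of `a` on both sides, every element of `tBall n` is the value of a word of length
at most `n`: neighbouring powers of `t` merge, because `t` has order `3`. -/
theorem exists_val_of_mem_tBall {n : ℕ} {g : TreeAut} (hg : g ∈ tBall n) :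
    ∃ (i j : ℤ) (l : List (Bool × Bool)), l.length ≤ n ∧ g = a ^ i * (val l * a ^ j) := by
  induction hg with
  | one n => exact ⟨0, 0, [], Nat.zero_le _, by simp [val]⟩
  | a_mul z _ ih =>
    obtain ⟨i, j, l, hl, rfl⟩ := ih
    exact ⟨z + i, j, l, hl, by rw [zpow_add, mul_assoc]⟩
  | t_mul z _ ih =>
    obtain ⟨i, j, l, hl, rfl⟩ := ih
    rcases zpow_eq_of_pow_three t_pow_three z with hz | ⟨e, hz⟩
    · exact ⟨i, j, l, by omega, by rw [hz, one_mul]⟩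
    rw [hz]
    rcases zpow_eq_of_pow_three a_pow_three i with hi | ⟨d, hi⟩
    swap
    · exact ⟨0, j, (e, d) :: l, by simpa using hl, by simp [hi, val, mul_assoc]⟩
    rw [hi, one_mul]
    rcases l with _ | ⟨⟨e', d⟩, l⟩
    · exact ⟨0, j - 1, [(e, true)], by simp, by
        simp only [val, sgn, if_true, one_mul, mul_one, zpow_zero, zpow_one, mul_assoc]
        rw [← zpow_one_add, add_sub_cancel]⟩
    · rw [val, ← mul_assoc, ← mul_assoc, ← zpow_add]
      rcases zpow_eq_of_pow_three t_pow_three (sgn e + sgn e') with h | ⟨e'', h⟩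
      · refine ⟨sgn d, j, l, ?_, by rw [h, one_mul, mul_assoc]⟩
        simp only [List.length_cons] at hl
        omega
      · refine ⟨0, j, (e'', d) :: l, ?_, by rw [h, val, zpow_zero, one_mul, mul_assoc, mul_assoc]⟩
        simp only [List.length_cons] at hl ⊢
        omega

theorem exists_fin_zpow_a (z : ℤ) : ∃ i : Fin 3, a ^ z = a ^ (i : ℕ) := by
  have h2 : a ^ (-1 : ℤ) = a ^ 2 := by
    rw [zpow_neg_one, inv_eq_iff_mul_eq_one, ← pow_succ', a_pow_three]
  rcases zpow_eq_of_pow_three a_pow_three z with h | ⟨_ | _, h⟩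
  · exact ⟨0, by simp [h]⟩
  · exact ⟨2, by simpa [sgn, h] using h2⟩
  · exact ⟨1, by simp [sgn, h]⟩

theorem val_mem_tBall (l : List (Bool × Bool)) : val l ∈ tBall l.length := by
  induction l with
  | nil => exact .one 0
  | cons x l ih => exact .t_mul _ (.a_mul _ ih)

theorem val_append (l l' : List (Bool × Bool)) : val (l ++ l') = val l * val l' := by
  induction l with
  | nil => simp [val]
  | cons x l ih => simp [val, ih, mul_assoc]

/-! ### Windows in which two levels of sections lose length -/

/-- The filtration by the total length of the nine sections at the second level. -/
abbrev liftLift : ℕ → Set TreeAut := lift (lift tBall)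

theorem isLength_liftLift : IsLength liftLift := isLength_tBall.lift.lift

theorem a_mul_nodeHom_mul (x y z g : TreeAut) :
    a * (nodeHom (triple x y z) * g) = nodeHom (triple z x y) * (a * g) := by
  rw [← mul_assoc, a_mul_nodeHom, mul_assoc]

theorem a_inv_mul_nodeHom_mul (x y z g : TreeAut) :
    a⁻¹ * (nodeHom (triple x y z) * g) = nodeHom (triple y z x) * (a⁻¹ * g) := by
  rw [← mul_assoc, a_inv_mul_nodeHom, mul_assoc]

theorem nodeHom_triple_mul (x y z x' y' z' g : TreeAut) :
    nodeHom (triple x y z) * (nodeHom (triple x' y' z') * g) =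
      nodeHom (triple (x * x') (y * y') (z * z')) * g := by
  rw [← mul_assoc, ← map_mul, triple_mul]

theorem exists_t_zpow :
    ∃ T : ℤ → TreeAut, (∀ z, t ^ z = nodeHom (triple (a ^ z) 1 (T z))) ∧ ∀ z, T z = t ^ z :=
  ⟨fun z => t ^ z, t_zpow, fun _ => rfl⟩

theorem IsLength.a_mul_mem {P : ℕ → Set TreeAut} (hP : IsLength P) {n : ℕ} {g : TreeAut}
    (hg : g ∈ P n) : a * g ∈ P n := by
  simpa using hP.mul_mem (hP.a_mem 1) hg

theorem IsLength.a_inv_mul_mem {P : ℕ → Set TreeAut} (hP : IsLength P) {n : ℕ} {g : TreeAut}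
    (hg : g ∈ P n) : a⁻¹ * g ∈ P n := by
  simpa using hP.mul_mem (hP.a_mem (-1)) hg

/-- The two outer powers of `t` meet in the same section and are not separated there. -/
theorem turn_mem_lift (x y z : ℤ) {n : ℕ} {g : TreeAut} (hg : g ∈ lift tBall n) :
    t ^ x * (a * (t ^ y * (a⁻¹ * (t ^ z * g)))) ∈ lift tBall (2 + n) := by
  have hT := isLength_tBall
  obtain ⟨T, h1, h2⟩ := exists_t_zpow
  have : t ^ x * (a * (t ^ y * (a⁻¹ * (t ^ z * g)))) =
      nodeHom (triple (a ^ x * (T y * a ^ z)) (a ^ y) (T x * T z)) * g := by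
    simp only [h1, a_mul_nodeHom_mul, a_inv_mul_nodeHom_mul, mul_inv_cancel_left,
      nodeHom_triple_mul, one_mul, mul_one]
  rw [this, h2, h2, h2, ← zpow_add]
  exact hT.lift.mul_mem (nodeHom_mem_lift
    (hT.mul_mem (hT.a_mem _) (hT.mul_mem (t_zpow_mem_tBall _) (hT.a_mem _)))
    (hT.a_mem _) (t_zpow_mem_tBall _) le_rfl) hg

/-- The predicate on words that the first seven letters `t^{e₀} a^{d₀} ⋯ t^{e₆} a^{d₆}` are of one
of three types for which the sections at the second level have total length at most six.
Here `e i`, `d i` are read from the word with a default value that the length bound makes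
irrelevant. -/
def Bad (l : List (Bool × Bool)) : Prop :=
  7 ≤ l.length ∧
    (((l.getD 0 default).2 = true ∧ (l.getD 1 default).2 = false) ∨
      ((∀ i < 6, (l.getD i default).2 = true) ∧
        (l.getD 2 default).1 = true ∧ (l.getD 5 default).1 = false) ∨
      ((∀ i < 6, (l.getD i default).2 = false) ∧
        (l.getD 1 default).1 = true ∧ (l.getD 4 default).1 = false))

theorem lift_tBall_subset_liftLift (n : ℕ) : lift tBall n ⊆ liftLift n :=
  lift_mono tBall_subset_lift n

theorem t_zpow_mem_lift (z : ℤ) : t ^ z ∈ lift tBall 1 := tBall_subset_lift 1 (t_zpow_mem_tBall z)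

/-- When `a` always occurs with exponent `1`, the section at the vertex `2` is
`t^{e₀} a^{e₂} t^{e₃} a^{e₅} t^{e₆}`, so that opposite signs of `e₂` and `e₅` give a turn at the
second level. -/
theorem ascending_mem_liftLift (e₀ e₁ e₃ e₄ e₆ : ℤ) {n : ℕ} {g : TreeAut} (hg : g ∈ liftLift n) :
    t ^ e₀ * (a * (t ^ e₁ * (a * (t ^ (1 : ℤ) * (a * (t ^ e₃ * (a * (t ^ e₄ * (a *
      (t ^ (-1 : ℤ) * (a * (t ^ e₆ * g)))))))))))) ∈ liftLift (6 + n) := by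
  have hM := isLength_tBall.lift
  have hL := isLength_liftLift
  have ht := t_zpow_mem_lift
  obtain ⟨T, h1, h2⟩ := exists_t_zpow
  have key : ∀ e₂ e₅ : ℤ, t ^ e₀ * (a * (t ^ e₁ * (a * (t ^ e₂ * (a * (t ^ e₃ * (a * (t ^ e₄ * (a *
      (t ^ e₅ * (a * (t ^ e₆ * g)))))))))))) =
      nodeHom (triple (a ^ e₀ * (T e₁ * (a ^ e₃ * (T e₄ * a ^ e₆))))
        (a ^ e₁ * (T e₂ * (a ^ e₄ * T e₅)))
        (T e₀ * (a ^ e₂ * (T e₃ * (a ^ e₅ * T e₆))))) *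
          (a * (a * (a * (a * (a * (a * g)))))) := by
    intro e₂ e₅
    simp only [h1, a_mul_nodeHom_mul, nodeHom_triple_mul, one_mul, mul_one]
  rw [key]
  simp only [h2]
  have h3 : t ^ e₀ * (a ^ (1 : ℤ) * (t ^ e₃ * (a ^ (-1 : ℤ) * t ^ e₆))) ∈ lift tBall 2 := by
    have := turn_mem_lift e₀ e₃ e₆ hM.one_mem
    rwa [mul_one, ← zpow_neg_one, ← zpow_one a, ← zpow_mul, one_mul] at this
  exact hL.mul_mem (nodeHom_mem_lift
    (hM.mul_mem (hM.a_mem _) (hM.mul_mem (ht _) (hM.mul_mem (hM.a_mem _)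
      (hM.mul_mem (ht _) (hM.a_mem _)))))
    (hM.mul_mem (hM.a_mem _) (hM.mul_mem (ht _) (hM.mul_mem (hM.a_mem _) (ht _))))
    h3 le_rfl) (hL.a_mul_mem (hL.a_mul_mem (hL.a_mul_mem (hL.a_mul_mem (hL.a_mul_mem
      (hL.a_mul_mem hg))))))

/-- When `a` always occurs with exponent `-1`, the section at the vertex `2` is
`t^{e₀} a^{e₁} t^{e₃} a^{e₄} t^{e₆}`, so that opposite signs of `e₁` and `e₄` give a turn at the
second level. -/
theorem descending_mem_liftLift (e₀ e₂ e₃ e₅ e₆ : ℤ) {n : ℕ} {g : TreeAut} (hg : g ∈ liftLift n) :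
    t ^ e₀ * (a⁻¹ * (t ^ (1 : ℤ) * (a⁻¹ * (t ^ e₂ * (a⁻¹ * (t ^ e₃ * (a⁻¹ * (t ^ (-1 : ℤ) * (a⁻¹ *
      (t ^ e₅ * (a⁻¹ * (t ^ e₆ * g)))))))))))) ∈ liftLift (6 + n) := by
  have hM := isLength_tBall.lift
  have hL := isLength_liftLift
  have ht := t_zpow_mem_lift
  obtain ⟨T, h1, h2⟩ := exists_t_zpow
  have key : ∀ e₁ e₄ : ℤ,
      t ^ e₀ * (a⁻¹ * (t ^ e₁ * (a⁻¹ * (t ^ e₂ * (a⁻¹ * (t ^ e₃ * (a⁻¹ * (t ^ e₄ * (a⁻¹ *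
      (t ^ e₅ * (a⁻¹ * (t ^ e₆ * g)))))))))))) =
      nodeHom (triple (a ^ e₀ * (T e₂ * (a ^ e₃ * (T e₅ * a ^ e₆))))
        (T e₁ * (a ^ e₂ * (T e₄ * a ^ e₅)))
        (T e₀ * (a ^ e₁ * (T e₃ * (a ^ e₄ * T e₆))))) *
          (a⁻¹ * (a⁻¹ * (a⁻¹ * (a⁻¹ * (a⁻¹ * (a⁻¹ * g)))))) := by
    intro e₁ e₄
    simp only [h1, a_inv_mul_nodeHom_mul, nodeHom_triple_mul, one_mul, mul_one]
  rw [key]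
  simp only [h2]
  have h3 : t ^ e₀ * (a ^ (1 : ℤ) * (t ^ e₃ * (a ^ (-1 : ℤ) * t ^ e₆))) ∈ lift tBall 2 := by
    have := turn_mem_lift e₀ e₃ e₆ hM.one_mem
    rwa [mul_one, ← zpow_neg_one, ← zpow_one a, ← zpow_mul, one_mul] at this
  exact hL.mul_mem (nodeHom_mem_lift
    (hM.mul_mem (hM.a_mem _) (hM.mul_mem (ht _) (hM.mul_mem (hM.a_mem _)
      (hM.mul_mem (ht _) (hM.a_mem _)))))
    (hM.mul_mem (ht _) (hM.mul_mem (hM.a_mem _) (hM.mul_mem (ht _) (hM.a_mem _))))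
    h3 le_rfl) (hL.a_inv_mul_mem (hL.a_inv_mul_mem (hL.a_inv_mul_mem (hL.a_inv_mul_mem
      (hL.a_inv_mul_mem (hL.a_inv_mul_mem hg))))))

theorem val_mem_liftLift (l : List (Bool × Bool)) : val l ∈ liftLift l.length :=
  tBall_subset_lift_lift _ (val_mem_tBall l)

theorem val_mem_liftLift_of_bad {l : List (Bool × Bool)} (hl : Bad l) {m : ℕ}
    (hm : val (l.drop 7) ∈ liftLift m) : val l ∈ liftLift (6 + m) := by
  have hL := isLength_liftLift
  have ha : a ^ sgn true = a := zpow_one a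
  have ha' : a ^ sgn false = a⁻¹ := zpow_neg_one a
  obtain ⟨hlen, h⟩ := hl
  match l, hlen with
  | (e0, d0) :: (e1, d1) :: (e2, d2) :: (e3, d3) :: (e4, d4) :: (e5, d5) :: (e6, d6) :: r, _ =>
    have hr : a ^ sgn d6 * val r ∈ liftLift m := by
      have := hL.mul_mem (hL.a_mem (sgn d6)) hm
      rwa [zero_add] at this
    rcases h with ⟨h0, h1⟩ | ⟨hd, he2, he5⟩ | ⟨hd, he1, he4⟩
    · simp only [List.getD_cons_zero, List.getD_cons_succ] at h0 h1
      subst h0 h1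
      have hM := isLength_tBall.lift
      have h3 := turn_mem_lift (sgn e0) (sgn e1) (sgn e2) hM.one_mem
      have h4 : val ((e3, d3) :: (e4, d4) :: (e5, d5) :: (e6, d6) :: r) ∈ liftLift (4 + m) := by
        have := hL.mul_mem (val_mem_liftLift [(e3, d3), (e4, d4), (e5, d5), (e6, d6)]) hm
        rwa [← val_append] at this
      have h5 := hL.mul_mem (lift_tBall_subset_liftLift _ h3)
        (hL.mul_mem (hL.a_mem (sgn d2)) h4)
      have h6 : 2 + 0 + (0 + (4 + m)) = 6 + m := by omega
      rw [h6] at h5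
      simp only [mul_assoc, one_mul] at h5
      simp only [val, ha, ha']
      exact h5
    · simp only [List.getD_cons_zero, List.getD_cons_succ] at he2 he5
      have g0 := hd 0 (by norm_num)
      have g1 := hd 1 (by norm_num)
      have g2 := hd 2 (by norm_num)
      have g3 := hd 3 (by norm_num)
      have g4 := hd 4 (by norm_num)
      have g5 := hd 5 (by norm_num)
      simp only [List.getD_cons_zero, List.getD_cons_succ] at g0 g1 g2 g3 g4 g5
      subst he2 he5 g0 g1 g2 g3 g4 g5
      have := ascending_mem_liftLift (sgn e0) (sgn e1) (sgn e3) (sgn e4) (sgn e6) hr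
      simp only [val, ha]
      exact this
    · simp only [List.getD_cons_zero, List.getD_cons_succ] at he1 he4
      have g0 := hd 0 (by norm_num)
      have g1 := hd 1 (by norm_num)
      have g2 := hd 2 (by norm_num)
      have g3 := hd 3 (by norm_num)
      have g4 := hd 4 (by norm_num)
      have g5 := hd 5 (by norm_num)
      simp only [List.getD_cons_zero, List.getD_cons_succ] at g0 g1 g2 g3 g4 g5
      subst he1 he4 g0 g1 g2 g3 g4 g5
      have := descending_mem_liftLift (sgn e0) (sgn e2) (sgn e3) (sgn e5) (sgn e6) hr
      simp only [val, ha']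
      exact this

open Classical in
/-- The number of positions of a word at which a window as in `Bad` starts. -/
noncomputable def badCount : List (Bool × Bool) → ℕ
  | [] => 0
  | x :: l => badCount l + if Bad (x :: l) then 1 else 0

theorem badCount_le_drop (k : ℕ) (l : List (Bool × Bool)) :
    badCount l ≤ badCount (l.drop k) + k := by
  induction k generalizing l with
  | zero => simp
  | succ k ih =>
    cases l with
    | nil => simp [badCount]
    | cons x l =>
      have := ih l
      rw [List.drop_succ_cons, badCount]
      split_ifs <;> omega

/-- Among the bad windows one seventh can be chosen disjoint, and each of these saves one unit of
length at the second level. -/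
theorem exists_val_mem_liftLift (l : List (Bool × Bool)) :
    ∃ k m, badCount l ≤ 7 * k ∧ m + k ≤ l.length ∧ val l ∈ liftLift m := by
  induction h : l.length using Nat.strong_induction_on generalizing l with
  | _ n ih =>
    subst h
    cases l with
    | nil => exact ⟨0, 0, le_rfl, le_rfl, isLength_liftLift.one_mem⟩
    | cons x l =>
      by_cases hb : Bad (x :: l)
      · have hlen := hb.1
        obtain ⟨k, m, h1, h2, h3⟩ := ih ((x :: l).drop 7).length
          (by rw [List.length_drop]; omega) _ rfl
        have := badCount_le_drop 7 (x :: l)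
        rw [List.length_drop] at h2
        exact ⟨k + 1, 6 + m, by omega, by omega, val_mem_liftLift_of_bad hb h3⟩
      · obtain ⟨k, m, h1, h2, h3⟩ := ih l.length (by simp) l rfl
        refine ⟨k, 1 + m, by simpa [badCount, hb] using h1, by simp only [List.length_cons]; omega, ?_⟩
        have := isLength_liftLift.mul_mem (val_mem_liftLift [x]) h3
        rwa [← val_append] at this

/-! ### Words with few bad windows are nearly determined by a recursion -/

/-- The first letter that the rules `e j = e (j + 3)` and `d j = d (j + 1)` predict in front of a
given word. -/
def predict (l : List (Bool × Bool)) : Bool × Bool :=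
  ((l.getD 2 default).1, (l.getD 0 default).2)

/-- The number of letters of a word that differ from the one predicted by the letters to their
right. -/
def surprises : List (Bool × Bool) → ℕ
  | [] => 0
  | x :: l => surprises l + if x = predict l then 0 else 1

theorem sum_range_add_le (f : ℕ → ℕ) (n p C : ℕ) (hf : ∀ j, n ≤ j → f j ≤ C) :
    ∑ j ∈ Finset.range n, f (j + p) ≤ ∑ j ∈ Finset.range n, f j + p * C := by
  calc ∑ j ∈ Finset.range n, f (j + p) ≤ ∑ j ∈ Finset.range (p + n), f j := by
        rw [Finset.sum_range_add f p n]
        simp only [add_comm p]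
        exact Nat.le_add_left _ _
    _ = ∑ j ∈ Finset.range n, f j + ∑ j ∈ Finset.range p, f (n + j) := by
        rw [add_comm p n, Finset.sum_range_add]
    _ ≤ _ := by
        refine Nat.add_le_add_left ?_ _
        refine (Finset.sum_le_card_nsmul _ _ C fun j _ => hf _ (Nat.le_add_right _ _)).trans ?_
        simp

/-- In a Boolean sequence the ascents from `j` to `j + p` are at most `p` more than the
descents. -/
theorem sum_ne_le (u : ℕ → Bool) (n p : ℕ) :
    ∑ j ∈ Finset.range n, (if u j ≠ u (j + p) then 1 else 0) ≤
      2 * ∑ j ∈ Finset.range n, (if u j = true ∧ u (j + p) = false then 1 else 0) + p := by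
  have h1 : ∑ j ∈ Finset.range n, ((if u j ≠ u (j + p) then 1 else 0) + (u j).toNat) =
      ∑ j ∈ Finset.range n,
        (2 * (if u j = true ∧ u (j + p) = false then 1 else 0) + (u (j + p)).toNat) := by
    refine Finset.sum_congr rfl fun j _ => ?_
    cases u j <;> cases u (j + p) <;> rfl
  have h2 := sum_range_add_le (fun j => (u j).toNat) n p 1 fun j _ => Bool.toNat_le _
  rw [Finset.sum_add_distrib, Finset.sum_add_distrib, ← Finset.mul_sum] at h1
  omega

theorem sum_lt_add_le (n c : ℕ) :
    ∑ j ∈ Finset.range n, (if n < j + c then 1 else 0) ≤ c := by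
  rw [← Finset.card_filter]
  calc _ ≤ (Finset.Ico (n - c) n).card := Finset.card_le_card fun j hj => by
        simp only [Finset.mem_filter, Finset.mem_range] at hj
        rw [Finset.mem_Ico]
        omega
    _ ≤ c := by
        rw [Nat.card_Ico]
        omega

theorem getD_drop (l : List (Bool × Bool)) (i j : ℕ) :
    (l.drop j).getD i default = l.getD (j + i) default := by
  rw [List.getD_eq_getElem?_getD, List.getD_eq_getElem?_getD, List.getElem?_drop]

open Classical in
theorem badCount_eq_sum (l : List (Bool × Bool)) :
    badCount l = ∑ j ∈ Finset.range l.length, if Bad (l.drop j) then 1 else 0 := by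
  induction l with
  | nil => rfl
  | cons x l ih =>
    rw [List.length_cons, Finset.sum_range_succ', badCount, ih]
    simp

theorem surprises_le_sum (l : List (Bool × Bool)) :
    surprises l ≤
      ∑ j ∈ Finset.range l.length,
        (if (l.getD j default).2 ≠ (l.getD (j + 1) default).2 then 1 else 0) +
      ∑ j ∈ Finset.range l.length,
        (if (l.getD j default).1 ≠ (l.getD (j + 3) default).1 then 1 else 0) := by
  induction l with
  | nil => simp [surprises]
  | cons x l ih =>
    rw [List.length_cons, Finset.sum_range_succ', Finset.sum_range_succ', surprises]
    have h : (if x = predict l then 0 else 1) ≤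
        (if x.2 ≠ (l.getD 0 default).2 then 1 else 0) +
          if x.1 ≠ (l.getD 2 default).1 then 1 else 0 := by
      by_cases h2 : x.2 = (l.getD 0 default).2
      · by_cases h1 : x.1 = (l.getD 2 default).1
        · have h : x = predict l := Prod.ext_iff.2 ⟨h1, h2⟩
          rw [if_pos h]
          exact Nat.zero_le _
        · rw [if_pos h1]
          split_ifs <;> omega
      · rw [if_pos h2]
        split_ifs <;> omega
    have h3 : ∀ j, (x :: l).getD (j + 1 + 3) default = l.getD (j + 3) default := fun _ => rfl
    have h0 : (x :: l).getD (0 + 3) default = l.getD 2 default := rfl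
    simp only [List.getD_cons_succ, List.getD_cons_zero, h3, h0]
    omega

/-- Away from bad windows the signs of the powers of `a` can change only from `-` to `+`, and where
these signs are constant, the signs of the powers of `t` in a residue class modulo `3` can change
only from `-` to `+`. Hence every bad window accounts for boundedly many surprises. -/
theorem surprises_le (l : List (Bool × Bool)) : surprises l ≤ 34 * badCount l + 248 := by
  classical
  set n := l.length with hn
  set e : ℕ → Bool := fun j => (l.getD j default).1 with he
  set d : ℕ → Bool := fun j => (l.getD j default).2 with hd
  set B : ℕ → ℕ := fun j => if Bad (l.drop j) then 1 else 0 with hB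
  set C : ℕ → ℕ := fun j => if d j ≠ d (j + 1) then 1 else 0 with hC
  have hF : badCount l = ∑ j ∈ Finset.range n, B j := badCount_eq_sum l
  have hS : surprises l ≤ ∑ j ∈ Finset.range n, C j +
      ∑ j ∈ Finset.range n, (if e j ≠ e (j + 3) then 1 else 0) := surprises_le_sum l
  have hA : ∑ j ∈ Finset.range n, C j ≤ _ := sum_ne_le d n 1
  have hE := sum_ne_le e n 3
  have hA' : ∑ j ∈ Finset.range n, (if d j = true ∧ d (j + 1) = false then 1 else 0) ≤
      ∑ j ∈ Finset.range n, B j + 7 := by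
    calc _ ≤ ∑ j ∈ Finset.range n, (B j + if n < j + 7 then 1 else 0) := by
          refine Finset.sum_le_sum fun j _ => ?_
          by_cases hj : n < j + 7
          · rw [if_pos hj]
            split_ifs <;> omega
          split_ifs with h
          · have : Bad (l.drop j) := by
              refine ⟨by rw [List.length_drop]; omega, .inl ?_⟩
              rw [getD_drop, getD_drop]
              exact h
            simp [hB, this]
          · exact Nat.zero_le _
      _ ≤ _ := by
          rw [Finset.sum_add_distrib]
          exact Nat.add_le_add_left (sum_lt_add_le n 7) _
  have hB0 : ∀ j, n ≤ j → B j ≤ 0 := by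
    intro j hj
    have : ¬ Bad (l.drop j) := fun h => by
      have := h.1
      rw [List.length_drop] at this
      omega
    simp [hB, this]
  have hC0 : ∀ j, n ≤ j → C j ≤ 0 := by
    intro j hj
    have h1 : d j = false := by simp only [hd]; rw [List.getD_eq_default _ _ hj]; rfl
    have h2 : d (j + 1) = false := by
      simp only [hd]; rw [List.getD_eq_default _ _ (hj.trans (Nat.le_succ j))]; rfl
    simp [hC, h1, h2]
  have hE' : ∑ j ∈ Finset.range n, (if e j = true ∧ e (j + 3) = false then 1 else 0) ≤
      2 * ∑ j ∈ Finset.range n, B j + 7 * ∑ j ∈ Finset.range n, C j + 10 := by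
    set D : ℕ → ℕ := fun j => if e j = true ∧ e (j + 3) = false then 1 else 0 with hD
    have hD1 : ∀ j, D j ≤ 1 := fun j => by
      simp only [hD]
      split_ifs <;> omega
    -- A descent at `j + 2` forces a bad window at `j` or at `j + 1`, unless the signs of the powers
    -- of `a` change nearby or the word ends.
    have key : ∀ j, D (2 + j) ≤ B j + B (j + 1) + ∑ i ∈ Finset.range 7, C (j + i) +
        if n < j + 8 then 1 else 0 := by
      intro j
      by_contra! hlt
      have hDj := hD1 (2 + j)
      have hj : ¬ n < j + 8 := fun h => by
        rw [if_pos h] at hlt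
        omega
      have hsum : ∑ i ∈ Finset.range 7, C (j + i) = 0 := by omega
      have hDe : D (2 + j) = 1 := by omega
      have hdesc : e (2 + j) = true ∧ e (2 + j + 3) = false := by
        by_contra h
        simp [hD, h] at hDe
      have hstep : ∀ i < 7, d (j + (i + 1)) = d (j + i) := by
        intro i hi
        have := Finset.sum_eq_zero_iff.1 hsum i (Finset.mem_range.2 hi)
        by_contra h
        have h' : d (j + i) ≠ d (j + i + 1) := fun h'' => h h''.symm
        simp [hC, h'] at this
      have hconst : ∀ i < 8, d (j + i) = d j := by
        intro i
        induction i with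
        | zero => intro _; rfl
        | succ i ih =>
          intro hi
          rw [hstep i (by omega), ih (by omega)]
      cases hdj : d j with
      | true =>
        have : Bad (l.drop j) := by
          refine ⟨by rw [List.length_drop]; omega, .inr (.inl ⟨fun i hi => ?_, ?_, ?_⟩)⟩
          · rw [getD_drop]
            exact (hconst i (by omega)).trans hdj
          · rw [getD_drop, add_comm]
            exact hdesc.1
          · rw [getD_drop, show j + 5 = 2 + j + 3 by omega]
            exact hdesc.2
        have hBj : B j = 1 := by simp [hB, this]
        omega
      | false =>
        have : Bad (l.drop (j + 1)) := by
          refine ⟨by rw [List.length_drop]; omega, .inr (.inr ⟨fun i hi => ?_, ?_, ?_⟩)⟩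
          · rw [getD_drop, show j + 1 + i = j + (i + 1) by omega]
            exact (hconst (i + 1) (by omega)).trans hdj
          · rw [getD_drop, show j + 1 + 1 = 2 + j by omega]
            exact hdesc.1
          · rw [getD_drop, show j + 1 + 4 = 2 + j + 3 by omega]
            exact hdesc.2
        have hBj : B (j + 1) = 1 := by simp [hB, this]
        omega
    calc ∑ j ∈ Finset.range n, D j ≤ ∑ j ∈ Finset.range (2 + n), D j :=
          Finset.sum_le_sum_of_subset (Finset.range_mono (Nat.le_add_left n 2))
      _ = ∑ j ∈ Finset.range 2, D j + ∑ j ∈ Finset.range n, D (2 + j) :=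
          Finset.sum_range_add D 2 n
      _ ≤ 2 + ∑ j ∈ Finset.range n, (B j + B (j + 1) + ∑ i ∈ Finset.range 7, C (j + i) +
            if n < j + 8 then 1 else 0) := by
          refine add_le_add ?_ (Finset.sum_le_sum fun j _ => key j)
          have h0 := hD1 0
          have h1 := hD1 1
          rw [Finset.sum_range_succ, Finset.sum_range_one]
          omega
      _ ≤ _ := by
          rw [Finset.sum_add_distrib, Finset.sum_add_distrib, Finset.sum_add_distrib,
            Finset.sum_comm]
          have h1 := sum_range_add_le B n 1 0 hB0
          have h2 := sum_lt_add_le n 8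
          have h3 : ∑ i ∈ Finset.range 7, ∑ j ∈ Finset.range n, C (j + i) ≤
              7 * ∑ j ∈ Finset.range n, C j := by
            refine (Finset.sum_le_card_nsmul _ _ (∑ j ∈ Finset.range n, C j) fun i _ => ?_).trans ?_
            · exact sum_range_add_le C n i 0 hC0
            · simp
          omega
  omega

/-! ### Counting -/

theorem surprises_le_length (l : List (Bool × Bool)) : surprises l ≤ l.length := by
  induction l with
  | nil => rfl
  | cons x l ih =>
    rw [surprises, List.length_cons]
    split_ifs <;> omega

/-- The words of length `n` with at most `K` surprises. -/
def words (n K : ℕ) : Set (List (Bool × Bool)) := {l | l.length = n ∧ surprises l ≤ K}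

theorem words_finite (n K : ℕ) : (words n K).Finite :=
  (List.finite_length_eq (Bool × Bool) n).subset fun _ h => h.1

/-- A word is obtained from a shorter one by adding either the predicted letter or, at the cost of
one surprise, one of four letters. -/
theorem ncard_words_le {q : ℝ} (hq : 1 ≤ q) (n K : ℕ) :
    ((words n K).ncard : ℝ) ≤ (1 + 4 / q) ^ n * q ^ K := by
  have hq0 : 0 < q := by linarith
  induction n generalizing K with
  | zero =>
    have : words 0 K ⊆ {[]} := fun l h => List.length_eq_zero_iff.1 h.1
    have h1 : (words 0 K).ncard ≤ 1 :=
      (Set.ncard_le_ncard this).trans (by rw [Set.ncard_singleton])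
    calc ((words 0 K).ncard : ℝ) ≤ 1 := by exact_mod_cast h1
      _ ≤ (1 + 4 / q) ^ 0 * q ^ K := by
        rw [pow_zero, one_mul]
        exact one_le_pow₀ hq
  | succ n ih =>
    have hpred : ((fun l => predict l :: l) '' words n K).ncard ≤ (words n K).ncard :=
      Set.ncard_image_le (words_finite n K)
    cases K with
    | zero =>
      have hsub : words (n + 1) 0 ⊆ (fun l => predict l :: l) '' words n 0 := by
        rintro (_ | ⟨x, l⟩) ⟨h1, h2⟩
        · simp at h1
        · rw [surprises] at h2
          have hx : x = predict l := by
            by_contra h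
            rw [if_neg h] at h2
            omega
          exact ⟨l, ⟨by simpa using h1, by omega⟩, by rw [hx]⟩
      have h1 := (Set.ncard_le_ncard hsub ((words_finite n 0).image _)).trans hpred
      calc ((words (n + 1) 0).ncard : ℝ) ≤ (words n 0).ncard := by exact_mod_cast h1
        _ ≤ (1 + 4 / q) ^ n * q ^ 0 := ih 0
        _ ≤ (1 + 4 / q) ^ (n + 1) * q ^ 0 := by
          gcongr
          · have : 0 ≤ 4 / q := by positivity
            linarith
          · exact Nat.le_succ n
    | succ K =>
      have hsub : words (n + 1) (K + 1) ⊆ (fun l => predict l :: l) '' words n (K + 1) ∪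
          ⋃ x : Bool × Bool, (fun l => x :: l) '' words n K := by
        rintro (_ | ⟨x, l⟩) ⟨h1, h2⟩
        · simp at h1
        · rw [surprises] at h2
          by_cases hx : x = predict l
          · rw [if_pos hx] at h2
            exact .inl ⟨l, ⟨by simpa using h1, by omega⟩, by rw [hx]⟩
          · rw [if_neg hx] at h2
            exact .inr (Set.mem_iUnion.2 ⟨x, l, ⟨by simpa using h1, by omega⟩, rfl⟩)
      have hfin := ((words_finite n (K + 1)).image fun l => predict l :: l).union
        (Set.finite_iUnion fun x : Bool × Bool => (words_finite n K).image fun l => x :: l)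
      have h1 : (words (n + 1) (K + 1)).ncard ≤ (words n (K + 1)).ncard + 4 * (words n K).ncard := by
        refine (Set.ncard_le_ncard hsub hfin).trans ((Set.ncard_union_le _ _).trans ?_)
        refine add_le_add hpred ((Set.ncard_iUnion_le_of_fintype _).trans ?_)
        refine (Finset.sum_le_card_nsmul _ _ _ fun x _ =>
          Set.ncard_image_le (words_finite n K)).trans ?_
        simp
      calc ((words (n + 1) (K + 1)).ncard : ℝ)
          ≤ (words n (K + 1)).ncard + 4 * (words n K).ncard := by exact_mod_cast h1
        _ ≤ (1 + 4 / q) ^ n * q ^ (K + 1) + 4 * ((1 + 4 / q) ^ n * q ^ K) := by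
          gcongr
          · exact ih (K + 1)
          · exact ih K
        _ = (1 + 4 / q) ^ n * q ^ K * (q + 4) := by ring
        _ = (1 + 4 / q) ^ n * q ^ K * ((1 + 4 / q) * q) := by
          congr 1
          field_simp
        _ = (1 + 4 / q) ^ (n + 1) * q ^ (K + 1) := by ring

/-- The automorphisms that are, up to powers of `a` on both sides, values of words of length at most
`n` with at most `K` surprises. -/
def tameBall (n K : ℕ) : Set TreeAut :=
  {g | ∃ (i j : ℤ) (l : List (Bool × Bool)), l.length ≤ n ∧ surprises l ≤ K ∧
    g = a ^ i * (val l * a ^ j)}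

theorem tameBall_subset (n K : ℕ) : tameBall n K ⊆ ⋃ x : Fin 3 × Fin 3 × Fin (n + 1),
    (fun l => a ^ (x.1 : ℕ) * (val l * a ^ (x.2.1 : ℕ))) '' words x.2.2 K := by
  rintro _ ⟨i, j, l, hl, hK, rfl⟩
  obtain ⟨i', hi⟩ := exists_fin_zpow_a i
  obtain ⟨j', hj⟩ := exists_fin_zpow_a j
  exact Set.mem_iUnion.2 ⟨(i', j', ⟨l.length, by omega⟩), l, ⟨rfl, hK⟩, by rw [hi, hj]⟩

theorem tameBall_finite (n K : ℕ) : (tameBall n K).Finite :=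
  (Set.finite_iUnion fun _ => (words_finite _ _).image _).subset (tameBall_subset n K)

theorem ncard_tameBall_le {q : ℝ} (hq : 1 ≤ q) (n K : ℕ) :
    ((tameBall n K).ncard : ℝ) ≤ 9 * (n + 1) * ((1 + 4 / q) ^ n * q ^ K) := by
  have hq0 : 0 < q := by linarith
  have h1 := (Set.ncard_le_ncard (tameBall_subset n K)
    (Set.finite_iUnion fun _ => (words_finite _ _).image _)).trans
      (Set.ncard_iUnion_le_of_fintype _)
  calc ((tameBall n K).ncard : ℝ) ≤ ∑ x : Fin 3 × Fin 3 × Fin (n + 1),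
        (((fun l => a ^ (x.1 : ℕ) * (val l * a ^ (x.2.1 : ℕ))) '' words x.2.2 K).ncard : ℝ) := by
        exact_mod_cast h1
    _ ≤ ∑ _x : Fin 3 × Fin 3 × Fin (n + 1), (1 + 4 / q) ^ n * q ^ K := by
        refine Finset.sum_le_sum fun x _ => ?_
        calc _ ≤ ((words x.2.2 K).ncard : ℝ) := by
              exact_mod_cast Set.ncard_image_le (words_finite _ _)
          _ ≤ (1 + 4 / q) ^ (x.2.2 : ℕ) * q ^ K := ncard_words_le hq _ _
          _ ≤ (1 + 4 / q) ^ n * q ^ K := by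
              gcongr
              · have : 0 ≤ 4 / q := by positivity
                linarith
              · omega
    _ = 9 * (n + 1) * ((1 + 4 / q) ^ n * q ^ K) := by
        rw [Finset.sum_const, Finset.card_univ, nsmul_eq_mul]
        simp only [Fintype.card_prod, Fintype.card_fin]
        push_cast
        ring

theorem tBall_subset_tameBall (n : ℕ) : tBall n ⊆ tameBall n n := by
  intro g hg
  obtain ⟨i, j, l, hl, h⟩ := exists_val_of_mem_tBall hg
  exact ⟨i, j, l, hl, (surprises_le_length l).trans hl, h⟩

theorem tBall_finite (n : ℕ) : (tBall n).Finite := (tameBall_finite n n).subset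
  (tBall_subset_tameBall n)

/-- An element of length `n` either loses `s` units of length on the second level or comes from a
word with few surprises: if it loses `k < s` units, then the word has at most `7 * k` bad windows,
hence at most `34 * (7 * k) + 248 ≤ 248 * s` surprises. -/
theorem tBall_subset_union (n : ℕ) {s : ℕ} (hs : 1 ≤ s) :
    tBall n ⊆ tameBall n (248 * s) ∪ liftLift (n - s) := by
  intro g hg
  obtain ⟨i, j, l, hl, rfl⟩ := exists_val_of_mem_tBall hg
  obtain ⟨k, m, h1, h2, h3⟩ := exists_val_mem_liftLift l
  have hL := isLength_liftLift
  rcases le_or_gt s k with hk | hk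
  · right
    have := hL.mul_mem (hL.a_mem i) (hL.mul_mem h3 (hL.a_mem j))
    exact hL.mono (by omega) this
  · left
    have := surprises_le l
    exact ⟨i, j, l, hl, by omega, rfl⟩

theorem lift_subset {P : ℕ → Set TreeAut} (hP : ∀ m, (P m).Finite) (n : ℕ) :
    lift P n ⊆ ⋃ x : ZMod 3 × {k : ZMod 3 → Fin (n + 1) // ∑ v, (k v : ℕ) ≤ n},
      (fun f => node f (Equiv.addRight x.1)) ''
        (Fintype.piFinset fun v => (hP (x.2.1 v)).toFinset : Set (ZMod 3 → TreeAut)) := by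
  rintro _ ⟨f, s, k, rfl, hf, hk⟩
  have hlt : ∀ v, k v < n + 1 := fun v => Nat.lt_succ_of_le
    ((Finset.single_le_sum (fun _ _ => Nat.zero_le _) (Finset.mem_univ v)).trans hk)
  exact Set.mem_iUnion.2 ⟨(s, ⟨fun v => ⟨k v, hlt v⟩, hk⟩), f, by simpa using hf, rfl⟩

theorem lift_finite {P : ℕ → Set TreeAut} (hP : ∀ m, (P m).Finite) (n : ℕ) :
    (lift P n).Finite :=
  (Set.finite_iUnion fun _ => (Finset.finite_toSet _).image _).subset (lift_subset hP n)

theorem ncard_lift_le {P : ℕ → Set TreeAut} (hP : ∀ m, (P m).Finite) {h r : ℝ} (hh : 0 ≤ h)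
    (hr : 1 ≤ r) (n : ℕ) (hb : ∀ m ≤ n, ((P m).ncard : ℝ) ≤ h * r ^ m) :
    ((lift P n).ncard : ℝ) ≤ 3 * (n + 1) ^ 3 * h ^ 3 * r ^ n := by
  classical
  have h1 := (Set.ncard_le_ncard (lift_subset hP n)
    (Set.finite_iUnion fun _ => (Finset.finite_toSet _).image _)).trans
      (Set.ncard_iUnion_le_of_fintype _)
  have hcard : Fintype.card (ZMod 3 × {k : ZMod 3 → Fin (n + 1) // ∑ v, (k v : ℕ) ≤ n}) ≤
      3 * (n + 1) ^ 3 := by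
    rw [Fintype.card_prod, ZMod.card]
    refine Nat.mul_le_mul_left 3 ((Fintype.card_subtype_le _).trans ?_)
    simp [ZMod.card]
  calc ((lift P n).ncard : ℝ)
      ≤ ∑ x : ZMod 3 × {k : ZMod 3 → Fin (n + 1) // ∑ v, (k v : ℕ) ≤ n},
        (((fun f => node f (Equiv.addRight x.1)) ''
        (Fintype.piFinset fun v => (hP (x.2.1 v)).toFinset : Set (ZMod 3 → TreeAut))).ncard : ℝ) := by
        exact_mod_cast h1
    _ ≤ ∑ _x : ZMod 3 × {k : ZMod 3 → Fin (n + 1) // ∑ v, (k v : ℕ) ≤ n}, h ^ 3 * r ^ n := by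
        refine Finset.sum_le_sum fun x _ => ?_
        have h2 := Set.ncard_image_le (f := fun f => node f (Equiv.addRight x.1))
          (Finset.finite_toSet (Fintype.piFinset fun v => (hP (x.2.1 v)).toFinset))
        rw [Set.ncard_coe_finset, Fintype.card_piFinset] at h2
        calc _ ≤ ((∏ v, (hP (x.2.1 v)).toFinset.card : ℕ) : ℝ) := by exact_mod_cast h2
          _ = ∏ v, ((P (x.2.1 v)).ncard : ℝ) := by
              push_cast
              refine Finset.prod_congr rfl fun v _ => ?_
              rw [Set.ncard_eq_toFinset_card _ (hP _)]
          _ ≤ ∏ v, h * r ^ (x.2.1 v : ℕ) :=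
              Finset.prod_le_prod (fun _ _ => Nat.cast_nonneg _)
                fun v _ => hb _ (Nat.le_of_lt_succ (x.2.1 v).2)
          _ = h ^ 3 * r ^ (∑ v, (x.2.1 v : ℕ)) := by
              rw [Finset.prod_mul_distrib, Finset.prod_pow_eq_pow_sum, Finset.prod_const,
                Finset.card_univ, ZMod.card]
          _ ≤ h ^ 3 * r ^ n := by
              gcongr
              exact x.2.2
    _ ≤ 3 * (n + 1) ^ 3 * h ^ 3 * r ^ n := by
        rw [Finset.sum_const, Finset.card_univ, nsmul_eq_mul, mul_assoc (3 * ((n : ℝ) + 1) ^ 3)]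
        have : (0 : ℝ) ≤ h ^ 3 * r ^ n := by positivity
        gcongr
        exact_mod_cast hcard

theorem ncard_liftLift_le {h r : ℝ} (hh : 0 ≤ h) (hr : 1 ≤ r)
    (hb : ∀ m, ((tBall m).ncard : ℝ) ≤ h * r ^ m) (n : ℕ) :
    ((liftLift n).ncard : ℝ) ≤ 81 * (n + 1) ^ 12 * h ^ 9 * r ^ n := by
  have h1 := ncard_lift_le (lift_finite tBall_finite) (h := 3 * (n + 1) ^ 3 * h ^ 3)
    (by positivity) hr n fun m hm => by
      refine (ncard_lift_le tBall_finite hh hr m fun m' _ => hb m').trans ?_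
      gcongr
  refine h1.trans (le_of_eq ?_)
  ring

/-- The recursion behind the upper bound: a bound `h * r ^ m` for the size of `tBall m` is fed into the
count of the elements that lose `s` units of length on the second level. -/
theorem ncard_tBall_le {h r q : ℝ} (hh : 0 ≤ h) (hr : 1 ≤ r) (hq : 1 ≤ q)
    (hb : ∀ m, ((tBall m).ncard : ℝ) ≤ h * r ^ m) (n : ℕ) {s : ℕ} (hs : 1 ≤ s) :
    ((tBall n).ncard : ℝ) ≤ 9 * (n + 1) * ((1 + 4 / q) ^ n * q ^ (248 * s)) +
      81 * (n + 1) ^ 12 * h ^ 9 * r ^ (n - s) := by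
  have h1 := (Set.ncard_le_ncard (tBall_subset_union n hs) ((tameBall_finite _ _).union
    (lift_finite (lift_finite tBall_finite) _))).trans (Set.ncard_union_le _ _)
  calc ((tBall n).ncard : ℝ)
      ≤ (tameBall n (248 * s)).ncard + (liftLift (n - s)).ncard := by exact_mod_cast h1
    _ ≤ _ := by
      refine add_le_add (ncard_tameBall_le hq _ _) ((ncard_liftLift_le hh hr hb (n - s)).trans ?_)
      gcongr
      exact Nat.sub_le n s

/-! ### The upper bound -/

theorem one_le_log_of_three_le {x : ℝ} (hx : 3 ≤ x) : 1 ≤ Real.log x := by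
  rw [Real.le_log_iff_exp_le (by linarith)]
  have := Real.exp_one_lt_d9
  linarith

theorem nat_add_one_le_mul_exp (n : ℕ) {q : ℝ} (hq : 1 ≤ q) :
    (n : ℝ) + 1 ≤ q * Real.exp (n / q) := by
  have h1 := mul_le_mul_of_nonneg_left (Real.add_one_le_exp ((n : ℝ) / q))
    (by linarith : (0 : ℝ) ≤ q)
  rw [mul_add, mul_div_cancel₀ _ (by linarith : q ≠ 0)] at h1
  linarith

/-- The number of elements that lose few units of length, when `q` is the inverse of the proportion
of length that the other elements lose. -/
theorem tame_term_le (n : ℕ) {q : ℕ} (hq : 3 ≤ q) :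
    9 * ((n : ℝ) + 1) * ((1 + 4 / (q : ℝ)) ^ n * (q : ℝ) ^ (248 * (2 * (n / q + 1)))) ≤
      9 * Real.exp (501 * Real.log q / q * n + 497 * Real.log q) := by
  have hq' : (3 : ℝ) ≤ q := by exact_mod_cast hq
  have hq0 : (0 : ℝ) < q := by linarith
  have hL := one_le_log_of_three_le hq'
  set L := Real.log q with hLdef
  have hexp : Real.exp L = q := Real.exp_log hq0
  have h1 := nat_add_one_le_mul_exp n (by linarith : (1 : ℝ) ≤ q)
  rw [← hexp, ← Real.exp_add, hexp] at h1
  have h2 : (1 + 4 / (q : ℝ)) ^ n ≤ Real.exp (n * (4 / q)) := by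
    rw [Real.exp_nat_mul, add_comm]
    gcongr
    exact Real.add_one_le_exp _
  have h3 : (q : ℝ) ^ (248 * (2 * (n / q + 1))) ≤ Real.exp (496 * (n / q + 1) * L) := by
    rw [← hexp, ← Real.exp_nat_mul, hexp]
    gcongr
    push_cast
    have : ((n / q : ℕ) : ℝ) ≤ n / q := Nat.cast_div_le
    linarith
  have h4 : (0 : ℝ) ≤ n / q := by positivity
  calc 9 * ((n : ℝ) + 1) * ((1 + 4 / (q : ℝ)) ^ n * (q : ℝ) ^ (248 * (2 * (n / q + 1))))
      ≤ 9 * Real.exp (L + n / q) *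
        (Real.exp (n * (4 / q)) * Real.exp (496 * (n / q + 1) * L)) := by gcongr
    _ = 9 * Real.exp (L + n / q + (n * (4 / q) + 496 * (n / q + 1) * L)) := by
        rw [Real.exp_add (L + n / q), Real.exp_add (n * (4 / q))]
        ring
    _ ≤ _ := by
        refine mul_le_mul_of_nonneg_left (Real.exp_le_exp.2 ?_) (by norm_num)
        have h5 : (n : ℝ) / q ≤ n / q * L := le_mul_of_one_le_right h4 hL
        calc L + n / q + (n * (4 / q) + 496 * (n / q + 1) * L)
            = 5 * (n / q) + 496 * (n / q * L) + 497 * L := by ring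
          _ ≤ 5 * (n / q * L) + 496 * (n / q * L) + 497 * L := by linarith
          _ = 501 * L / q * n + 497 * L := by ring

/-- The growth rate decreases from `501 log k / k` to `501 log (k + 1) / (k + 1)` when `k`
increases by one, while the multiplicative constant is raised to a bounded power. -/
theorem ncard_tBall_le_exp (k : ℕ) (hk : 3 ≤ k) (n : ℕ) :
    ((tBall n).ncard : ℝ) ≤ Real.exp (501 * Real.log k / k * n + 100 * 18 ^ k) := by
  induction k, hk using Nat.le_induction generalizing n with
  | base =>
    have h1 := (ncard_tameBall_le (le_refl (1 : ℝ)) n n)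
    have h2 : ((tBall n).ncard : ℝ) ≤ (tameBall n n).ncard := by
      exact_mod_cast Set.ncard_le_ncard (tBall_subset_tameBall n) (tameBall_finite n n)
    have h3 : (1 + 4 / 1 : ℝ) ^ n ≤ Real.exp (n * 4) := by
      rw [Real.exp_nat_mul]
      gcongr
      have := Real.add_one_le_exp (4 : ℝ)
      linarith
    have h4 : (n : ℝ) + 1 ≤ Real.exp n := Real.add_one_le_exp _
    have h5 : (9 : ℝ) ≤ Real.exp 9 := by
      have := Real.add_one_le_exp (9 : ℝ)
      linarith
    have hL := one_le_log_of_three_le (le_refl (3 : ℝ))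
    have hn : (0 : ℝ) ≤ n := Nat.cast_nonneg n
    calc ((tBall n).ncard : ℝ) ≤ 9 * (n + 1) * ((1 + 4 / 1) ^ n * 1 ^ n) := h2.trans h1
      _ ≤ Real.exp 9 * Real.exp n * (Real.exp (n * 4) * 1) := by
          rw [one_pow]
          gcongr
      _ = Real.exp (9 + 5 * n) := by
          rw [mul_one, ← Real.exp_add, ← Real.exp_add]
          ring_nf
      _ ≤ _ := by
          refine Real.exp_le_exp.2 ?_
          push_cast
          have : (n : ℝ) ≤ Real.log 3 * n := le_mul_of_one_le_left hn hL
          linarith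
  | succ k hk ih =>
    have hk' : (3 : ℝ) ≤ k := by exact_mod_cast hk
    have hk0 : (0 : ℝ) < k := by linarith
    set q := k + 1 with hq
    have hq3 : (3 : ℝ) ≤ q := by rw [hq]; push_cast; linarith
    have hq0 : (0 : ℝ) < q := by linarith
    have hlogk := one_le_log_of_three_le hk'
    have hlogq := one_le_log_of_three_le hq3
    have hlog : Real.log k ≤ Real.log q := Real.log_le_log hk0 (by rw [hq]; push_cast; linarith)
    have hlogq' : Real.log q ≤ q := (Real.log_le_sub_one_of_pos hq0).trans (by linarith)
    set α := 501 * Real.log k / k with hα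
    set α' := 501 * Real.log q / q with hα'
    set β : ℝ := 100 * 18 ^ k with hβ
    set s := 2 * (n / q + 1) with hs
    have hα0 : 0 ≤ α := by positivity
    have hn0 : (0 : ℝ) ≤ n := Nat.cast_nonneg n
    have hexpq : Real.exp (Real.log q) = q := Real.exp_log hq0
    have hrec := ncard_tBall_le (h := Real.exp β) (r := Real.exp α) (q := q) (Real.exp_pos _).le
      (Real.one_le_exp hα0) (by linarith) (fun m => by
        rw [← Real.exp_nat_mul, ← Real.exp_add]
        refine (ih m).trans (le_of_eq ?_)
        ring_nf) n (s := s) (by rw [hs]; linarith [Nat.zero_le (n / q)])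
    have hfirst := tame_term_le n (q := q) (by exact_mod_cast hq3)
    have hns : ((n - s : ℕ) : ℝ) ≤ n * (1 - 2 / q) := by
      rcases le_or_gt s n with h | h
      · have h1 : (n : ℝ) / q ≤ (n / q : ℕ) + 1 := by
          rw [div_le_iff₀ hq0]
          have := Nat.lt_mul_div_succ n (show 0 < q by omega)
          have h2 : (n : ℝ) ≤ (q * (n / q + 1) : ℕ) := by exact_mod_cast this.le
          push_cast at h2
          linarith
        rw [Nat.cast_sub h, hs]
        push_cast
        have h2 : (n : ℝ) * (1 - 2 / q) = n - 2 * (n / q) := by ring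
        rw [h2]
        linarith
      · rw [Nat.sub_eq_zero_of_le h.le, Nat.cast_zero]
        refine mul_nonneg hn0 ?_
        rw [sub_nonneg, div_le_one hq0]
        linarith
    have hpoly : ((n : ℝ) + 1) ^ 12 ≤ Real.exp (24 * Real.log q + 12 * (n / (q : ℝ) ^ 2)) := by
      have h1 := nat_add_one_le_mul_exp n (one_le_pow₀ (by linarith : (1 : ℝ) ≤ q) : 1 ≤ (q : ℝ) ^ 2)
      have h2 : (q : ℝ) ^ 2 = Real.exp (2 * Real.log q) := by
        rw [two_mul, Real.exp_add, hexpq, pow_two]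
      calc ((n : ℝ) + 1) ^ 12 ≤ ((q : ℝ) ^ 2 * Real.exp (n / (q : ℝ) ^ 2)) ^ 12 := by gcongr
        _ = Real.exp (2 * Real.log q + n / (q : ℝ) ^ 2) ^ 12 := by rw [Real.exp_add, ← h2]
        _ = _ := by
          rw [← Real.exp_nat_mul]
          push_cast
          ring_nf
    have hrate : 12 * (n / (q : ℝ) ^ 2) + (n * (1 - 2 / q)) * α ≤ α' * n := by
      have h1 : α * (1 - 1 / q) ≤ α' := by
        have : α * (1 - 1 / q) = 501 * Real.log k / q := by
          rw [hα, hq]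
          push_cast
          field_simp
          ring
        rw [this, hα']
        gcongr
      have h2 : 12 / (q : ℝ) ^ 2 ≤ α / q := by
        rw [pow_two, ← div_div]
        gcongr
        rw [hα, div_le_div_iff₀ hq0 hk0]
        have : (k : ℝ) ≤ q := by rw [hq]; push_cast; linarith
        nlinarith
      have h3 : 12 / (q : ℝ) ^ 2 + (1 - 2 / q) * α ≤ α' := by
        have : (1 - 2 / q) * α = α * (1 - 1 / q) - α / q := by ring
        linarith
      calc _ = (12 / (q : ℝ) ^ 2 + (1 - 2 / q) * α) * n := by ring
        _ ≤ α' * n := by gcongr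
    have hsecond : 81 * ((n : ℝ) + 1) ^ 12 * Real.exp β ^ 9 * Real.exp α ^ (n - s) ≤
        81 * Real.exp (α' * n + (9 * β + 24 * Real.log q)) := by
      calc 81 * ((n : ℝ) + 1) ^ 12 * Real.exp β ^ 9 * Real.exp α ^ (n - s)
          ≤ 81 * Real.exp (24 * Real.log q + 12 * (n / (q : ℝ) ^ 2)) * Real.exp (9 * β) *
            Real.exp (n * (1 - 2 / q) * α) := by
            rw [← Real.exp_nat_mul, ← Real.exp_nat_mul]
            push_cast
            gcongr
        _ = 81 * Real.exp (24 * Real.log q + 12 * (n / (q : ℝ) ^ 2) + 9 * β +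
              n * (1 - 2 / q) * α) := by
            rw [Real.exp_add _ (n * (1 - 2 / q) * α), Real.exp_add _ (9 * β)]
            ring
        _ ≤ _ := by
            refine mul_le_mul_of_nonneg_left (Real.exp_le_exp.2 ?_) (by norm_num)
            linarith
    have hβ0 : 0 ≤ β := by positivity
    have h90 : (90 : ℝ) ≤ Real.exp 90 := by
      have := Real.add_one_le_exp (90 : ℝ)
      linarith
    have hpow : (q : ℝ) ≤ 18 ^ k := by
      have : k + 1 ≤ 18 ^ k := Nat.succ_le_of_lt (Nat.lt_pow_self (by norm_num))
      exact_mod_cast this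
    calc ((tBall n).ncard : ℝ)
        ≤ 9 * Real.exp (α' * n + 497 * Real.log q) +
          81 * Real.exp (α' * n + (9 * β + 24 * Real.log q)) :=
          hrec.trans (add_le_add hfirst hsecond)
      _ ≤ 9 * Real.exp (α' * n + (9 * β + 497 * Real.log q)) +
          81 * Real.exp (α' * n + (9 * β + 497 * Real.log q)) := by
          gcongr
          · linarith
          · norm_num
      _ = 90 * Real.exp (α' * n + (9 * β + 497 * Real.log q)) := by ring
      _ ≤ Real.exp 90 * Real.exp (α' * n + (9 * β + 497 * Real.log q)) := by gcongr
      _ = Real.exp (90 + (α' * n + (9 * β + 497 * Real.log q))) := by rw [← Real.exp_add]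
      _ ≤ Real.exp (α' * n + 100 * 18 ^ q) := by
          refine Real.exp_le_exp.2 ?_
          have : (18 : ℝ) ^ q = 18 ^ k * 18 := by rw [hq, pow_succ]
          linarith

theorem coe_mem_tBall {n : ℕ} {g : fabrykowskiGupta} (hg : g ∈ ball generators n) :
    (g : TreeAut) ∈ tBall n := by
  obtain ⟨l, hl, hs, rfl⟩ := hg
  have key : ∀ l : List fabrykowskiGupta, (∀ s ∈ l, s ∈ generators ∨ s⁻¹ ∈ generators) →
      (l.prod : TreeAut) ∈ tBall l.length := by
    intro l
    induction l with
    | nil => exact fun _ => .one 0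
    | cons x l ih =>
      intro h
      have hx : ∃ z : ℤ, (x : TreeAut) = a ^ z ∨ (x : TreeAut) = t ^ z := by
        rcases h x List.mem_cons_self with (h | h) | (h | h)
        · exact ⟨1, .inl (by rw [h, zpow_one])⟩
        · exact ⟨1, .inr (by rw [h, zpow_one])⟩
        · exact ⟨-1, .inl (by rw [zpow_neg_one, ← h, Subgroup.coe_inv, inv_inv])⟩
        · exact ⟨-1, .inr (by rw [zpow_neg_one, ← h, Subgroup.coe_inv, inv_inv])⟩
      have hl := ih fun s hs => h s (List.mem_cons_of_mem x hs)
      rw [List.prod_cons, Subgroup.coe_mul]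
      obtain ⟨z, hz | hz⟩ := hx
      · rw [hz]
        exact isLength_tBall.mono (Nat.le_succ _) (.a_mul z hl)
      · rw [hz]
        exact .t_mul z hl
  exact isLength_tBall.mono hl (key l hs)

theorem growth_le_ncard_tBall (n : ℕ) : growth generators n ≤ (tBall n).ncard :=
  Set.ncard_le_ncard_of_injOn Subtype.val (fun _ hg => coe_mem_tBall hg)
    Subtype.val_injective.injOn (tBall_finite n)

theorem growth_le_exp {k : ℕ} (hk : 3 ≤ k) (n : ℕ) :
    (growth generators n : ℝ) ≤ Real.exp (501 * Real.log k / k * n + 100 * 18 ^ k) :=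
  (Nat.cast_le.2 (growth_le_ncard_tBall n)).trans (ncard_tBall_le_exp k hk n)

theorem growth_isLittleO_pow {c : ℝ} (hc : 1 < c) :
    (fun n : ℕ => (growth generators n : ℝ)) =o[Filter.atTop] fun n : ℕ => c ^ n := by
  have hlogc := Real.log_pos hc
  have hlim : Filter.Tendsto (fun k : ℕ => 501 * Real.log k / k) Filter.atTop (nhds 0) := by
    have h1 : Filter.Tendsto (fun x : ℝ => Real.log x / x) Filter.atTop (nhds 0) := by
      simpa using Real.tendsto_pow_log_div_mul_add_atTop 1 0 1 one_ne_zero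
    have h2 := (h1.comp tendsto_natCast_atTop_atTop).const_mul 501
    simpa [Function.comp_def, mul_div_assoc] using h2
  obtain ⟨k, hk1, hk3⟩ := ((hlim.eventually (gt_mem_nhds (half_pos hlogc))).and
    (Filter.eventually_ge_atTop 3)).exists
  have hO : (fun n : ℕ => (growth generators n : ℝ)) =O[Filter.atTop]
      fun n : ℕ => Real.exp (Real.log c / 2) ^ n := by
    refine Asymptotics.IsBigO.of_bound (Real.exp (100 * 18 ^ k)) (Filter.Eventually.of_forall ?_)
    intro n
    rw [Real.norm_of_nonneg (Nat.cast_nonneg _), Real.norm_of_nonneg (by positivity),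
      ← Real.exp_nat_mul, ← Real.exp_add]
    refine (growth_le_exp hk3 n).trans (Real.exp_le_exp.2 ?_)
    have := mul_le_mul_of_nonneg_right hk1.le (Nat.cast_nonneg (α := ℝ) n)
    linarith
  refine hO.trans_isLittleO (isLittleO_pow_pow_of_lt_left (Real.exp_pos _).le ?_)
  calc Real.exp (Real.log c / 2) < Real.exp (Real.log c) := Real.exp_lt_exp.2 (by linarith)
    _ = c := Real.exp_log (by linarith)

/-- The bounds with rate `501 log k / k` are used for `k` close to `log n / 6`, so that `18 ^ k` is
at most the square root of `n`. -/
theorem growth_le_of_log_ge {n : ℕ} (hn : 24 ≤ Real.log n) :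
    (growth generators n : ℝ) ≤
      Real.exp (6112 * (n * Real.log (Real.log n) ^ 2 / Real.log n)) := by
  set x := Real.log n with hx
  have hx0 : 0 < x := by linarith
  have hnpos : (0 : ℝ) < n := by
    rcases Nat.eq_zero_or_pos n with h | h
    · rw [h, Nat.cast_zero, Real.log_zero] at hx
      linarith
    · exact_mod_cast h
  have hexp : Real.exp x = n := Real.exp_log hnpos
  set k := ⌊x / 6⌋₊ with hk
  have hk1 : (k : ℝ) ≤ x / 6 := Nat.floor_le (by linarith)
  have hk2 : x / 6 < k + 1 := Nat.lt_floor_add_one _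
  have hk3 : 3 ≤ k := by
    rw [hk, Nat.le_floor_iff (by linarith)]
    push_cast
    linarith
  have hk0 : (0 : ℝ) < k := by exact_mod_cast (by omega : 0 < k)
  have hlogx : 1 ≤ Real.log x := one_le_log_of_three_le (by linarith)
  have hlogk : Real.log k ≤ Real.log x := Real.log_le_log hk0 (by linarith)
  have hrate : Real.log k / k ≤ 12 * (Real.log x / x) := by
    calc Real.log k / k ≤ Real.log x / (x / 12) := by
          gcongr
          · linarith
      _ = _ := by field_simp
  have h18 : (18 : ℝ) ^ k ≤ Real.exp (x / 2) := by
    have h3 : (18 : ℝ) ≤ Real.exp 3 := by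
      have h1 : Real.exp 3 = Real.exp 1 ^ 3 := by
        rw [← Real.exp_nat_mul]
        norm_num
      have h2 := Real.exp_one_gt_d9
      have h4 : (2.7 : ℝ) ^ 3 ≤ Real.exp 1 ^ 3 := by
        gcongr
        linarith
      rw [h1]
      refine le_trans ?_ h4
      norm_num
    calc (18 : ℝ) ^ k ≤ Real.exp 3 ^ k := by gcongr
      _ = Real.exp (k * 3) := by rw [Real.exp_nat_mul]
      _ ≤ _ := by
          gcongr
          linarith
  have hsqrt : Real.exp (x / 2) ≤ n * (Real.log x / x) := by
    have h1 : x ≤ Real.exp (x / 2) := by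
      have h2 := Real.add_one_le_exp (x / 4)
      have h3 : Real.exp (x / 2) = Real.exp (x / 4) ^ 2 := by
        rw [← Real.exp_nat_mul]
        push_cast
        ring_nf
      rw [h3]
      nlinarith [sq_nonneg (x / 4 - 1)]
    have h2 : (n : ℝ) = Real.exp (x / 2) * Real.exp (x / 2) := by
      rw [← Real.exp_add, add_halves, hexp]
    rw [← mul_div_assoc, le_div_iff₀ hx0]
    calc Real.exp (x / 2) * x ≤ Real.exp (x / 2) * Real.exp (x / 2) := by gcongr
      _ = n := h2.symm
      _ ≤ n * Real.log x := le_mul_of_one_le_right hnpos.le hlogx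
  refine (growth_le_exp hk3 n).trans ?_
  gcongr
  calc 501 * Real.log k / k * n + 100 * 18 ^ k
      = 501 * (n * (Real.log k / k)) + 100 * 18 ^ k := by ring
    _ ≤ 501 * (n * (12 * (Real.log x / x))) + 100 * (n * (Real.log x / x)) := by
        gcongr
        exact h18.trans hsqrt
    _ = 6112 * (n * Real.log x / x) := by ring
    _ ≤ _ := by
        gcongr
        nlinarith

theorem growth_dominated :
    Dominated (fun n : ℕ => (growth generators n : ℝ))
      (fun n : ℕ => Real.exp ((n : ℝ) * Real.log (Real.log n) ^ 2 / Real.log n)) := by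
  -- Any constant that is large compared with its own logarithm will do.
  obtain ⟨M, hM1, hM2⟩ : ∃ M : ℕ, (27 : ℝ) ≤ M ∧ 584000 * (Real.log M + 24) ≤ M := by
    refine ⟨2 ^ 40, by norm_num, ?_⟩
    have : Real.log 2 ≤ 1 := (Real.log_le_sub_one_of_pos two_pos).trans (by norm_num)
    rw [Nat.cast_pow, Real.log_pow]
    norm_num
    linarith
  have hM0 : (0 : ℝ) < M := by linarith
  have hlogM : 3 ≤ Real.log M := by
    have h1 : Real.log 27 = 3 * Real.log 3 := by
      rw [show (27 : ℝ) = 3 ^ 3 by norm_num, Real.log_pow]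
      norm_num
    have h2 := one_le_log_of_three_le (le_refl (3 : ℝ))
    have h3 := Real.log_le_log (by norm_num) hM1
    linarith
  refine ⟨M, by exact_mod_cast hM0, fun n hn => ?_⟩
  have hn1 : (1 : ℝ) ≤ n := by exact_mod_cast hn
  have hn0 : (0 : ℝ) < n := by linarith
  have hlogn : 0 ≤ Real.log n := Real.log_nonneg hn1
  have hX : Real.log ((M * n : ℕ) : ℝ) = Real.log M + Real.log n := by
    rw [Nat.cast_mul, Real.log_mul hM0.ne' hn0.ne']
  simp only [hX]
  rw [Nat.cast_mul]
  set X := Real.log M + Real.log n with hXdef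
  have hX3 : 3 ≤ X := by linarith
  have hX0 : 0 < X := by linarith
  have hlogX := one_le_log_of_three_le hX3
  rcases lt_or_ge (Real.log n) 24 with h | h
  · refine (growth_le_exp le_rfl n).trans ?_
    gcongr
    have hlog3 : Real.log 3 ≤ 2 := (Real.log_le_sub_one_of_pos three_pos).trans (by norm_num)
    calc 501 * Real.log (3 : ℕ) / (3 : ℕ) * n + 100 * 18 ^ 3 ≤ 584000 * n := by
          push_cast
          nlinarith
      _ ≤ M * n / X := by
          rw [le_div_iff₀ hX0]
          have : 584000 * X ≤ M := by linarith
          nlinarith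
      _ ≤ M * n * Real.log X ^ 2 / X := by
          refine div_le_div_of_nonneg_right ?_ hX0.le
          exact le_mul_of_one_le_right (mul_nonneg hM0.le hn0.le) (one_le_pow₀ hlogX)
  · refine (growth_le_of_log_ge h).trans ?_
    gcongr
    have hlogx := one_le_log_of_three_le (by linarith : 3 ≤ Real.log n)
    have h1 : Real.log (Real.log n) ≤ Real.log X := Real.log_le_log (by linarith) (by linarith)
    calc 6112 * (n * Real.log (Real.log n) ^ 2 / Real.log n)
        ≤ 6112 * (n * Real.log X ^ 2 / Real.log n) := by gcongr
      _ = (n * Real.log X ^ 2) * (6112 / Real.log n) := by ring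
      _ ≤ (n * Real.log X ^ 2) * (M / X) := by
          refine mul_le_mul_of_nonneg_left ?_ (by positivity)
          rw [div_le_div_iff₀ (by linarith) hX0]
          have h2 : X ≤ Real.log n * (Real.log M + 1) := by nlinarith
          nlinarith
      _ = _ := by ring

/-! ### The lower bound -/

/-- `IsWord p q i j g`: the automorphism `g` is the value of a word with `p` letters `a^{±1}`, whose
exponents have sum `i`, and `q` letters `t^{±1}`, whose exponents have sum `j`. -/
inductive IsWord : ℕ → ℕ → ℤ → ℤ → TreeAut → Prop
  | one : IsWord 0 0 0 0 1
  | a_mul {p q : ℕ} {i j : ℤ} {g : TreeAut} (b : Bool) (h : IsWord p q i j g) :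
      IsWord (p + 1) q (sgn b + i) j (a ^ sgn b * g)
  | t_mul {p q : ℕ} {i j : ℤ} {g : TreeAut} (b : Bool) (h : IsWord p q i j g) :
      IsWord p (q + 1) i (sgn b + j) (t ^ sgn b * g)

theorem IsWord.mul {p q p' q' : ℕ} {i j i' j' : ℤ} {g h : TreeAut} (hg : IsWord p q i j g)
    (hh : IsWord p' q' i' j' h) : IsWord (p + p') (q + q') (i + i') (j + j') (g * h) := by
  induction hg with
  | one => simpa using hh
  | a_mul b _ ih =>
    rw [mul_assoc, add_assoc (sgn b), Nat.add_right_comm]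
    exact ih.a_mul b
  | t_mul b _ ih =>
    rw [mul_assoc, add_assoc (sgn b), Nat.add_right_comm]
    exact ih.t_mul b

theorem IsWord.a_conj {p q : ℕ} {i j : ℤ} {g : TreeAut} (h : IsWord p q i j g) :
    IsWord (p + 2) q i j (a * (g * a⁻¹)) := by
  have := ((h.mul (IsWord.one.a_mul false)).a_mul true)
  simpa [sgn] using this

theorem IsWord.a_inv_conj {p q : ℕ} {i j : ℤ} {g : TreeAut} (h : IsWord p q i j g) :
    IsWord (p + 2) q i j (a⁻¹ * (g * a)) := by
  have := ((h.mul (IsWord.one.a_mul true)).a_mul false)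
  simpa [sgn] using this

/-- The substitution `t ↦ t`, `a ↦ a⁻¹ t a` turns a word for `g` into a word for an automorphism that
has `g` as its third section and powers of `a` and `t` as its other sections. -/
theorem IsWord.substitution {p q : ℕ} {i j : ℤ} {g : TreeAut} (h : IsWord p q i j g) :
    IsWord (2 * p) (p + q) 0 (i + j) (nodeHom (triple (a ^ j) (t ^ i) g)) := by
  induction h with
  | one => simpa [triple_one] using IsWord.one
  | @a_mul p q i j g b _ ih =>
    have h1 := ((IsWord.one.t_mul b).a_inv_conj).mul ih
    have h2 : a⁻¹ * (t ^ sgn b * 1 * a) * nodeHom (triple (a ^ j) (t ^ i) g) =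
        nodeHom (triple (a ^ j) (t ^ (sgn b + i)) (a ^ sgn b * g)) := by
      rw [mul_one, t_zpow, ← mul_assoc, a_inv_mul_nodeHom, inv_mul_cancel_right, ← map_mul,
        triple_mul, one_mul, zpow_add]
    rw [h2] at h1
    convert h1 using 1 <;> omega
  | @t_mul p q i j g b _ ih =>
    have h1 := ih.t_mul b
    have h2 : t ^ sgn b * nodeHom (triple (a ^ j) (t ^ i) g) =
        nodeHom (triple (a ^ (sgn b + j)) (t ^ i) (t ^ sgn b * g)) := by
      rw [t_zpow, ← map_mul, triple_mul, one_mul, zpow_add, ← t_zpow]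
    rw [h2] at h1
    convert h1 using 1 <;> omega

theorem IsWord.exists_mem_ball {p q : ℕ} {i j : ℤ} {g : TreeAut} (h : IsWord p q i j g) :
    ∃ x ∈ ball generators (p + q), (x : TreeAut) = g := by
  have key : ∀ (n : ℕ) (s : TreeAut) (hs : s = a ∨ s = t) (b : Bool) (x : fabrykowskiGupta),
      x ∈ ball generators n →
        ∃ y ∈ ball generators (n + 1), (y : TreeAut) = s ^ sgn b * (x : TreeAut) := by
    rintro n s hs b x ⟨l, hl, hgen, rfl⟩
    have hsG : s ∈ fabrykowskiGupta := by
      apply Subgroup.subset_closure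
      rcases hs with rfl | rfl <;> simp
    set s' : fabrykowskiGupta := ⟨s, hsG⟩ with hs'
    have hmem : s' ∈ generators := hs
    refine ⟨s' ^ sgn b * l.prod, ⟨s' ^ sgn b :: l, by simpa using hl, ?_, by simp⟩, rfl⟩
    intro r hr
    rcases List.mem_cons.1 hr with rfl | hr
    · cases b
      · right
        simpa [sgn] using hmem
      · left
        simpa [sgn] using hmem
    · exact hgen r hr
  induction h with
  | one => exact ⟨1, ⟨[], by simp⟩, rfl⟩
  | @a_mul p q i j g b _ ih =>
    obtain ⟨x, hx, rfl⟩ := ih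
    obtain ⟨y, hy, hyx⟩ := key _ a (.inl rfl) b x hx
    exact ⟨y, by rwa [Nat.add_right_comm] at hy, hyx⟩
  | @t_mul p q i j g b _ ih =>
    obtain ⟨x, hx, rfl⟩ := ih
    obtain ⟨y, hy, hyx⟩ := key _ t (.inr rfl) b x hx
    exact ⟨y, hy, hyx⟩

/-- The elements of the commutator subgroup, in the form of words with vanishing exponent sums, that
need at most `n` letters `a^{±1}` and at most `n` letters `t^{±1}`. -/
def derivedBall (n : ℕ) : Set TreeAut := {g | ∃ p ≤ n, ∃ q ≤ n, IsWord p q 0 0 g}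

theorem derivedBall_subset (n : ℕ) :
    derivedBall n ⊆ Subtype.val '' (ball generators (2 * n) : Set fabrykowskiGupta) := by
  rintro g ⟨p, hp, q, hq, h⟩
  obtain ⟨x, ⟨l, hl, h1, h2⟩, hxg⟩ := h.exists_mem_ball
  exact ⟨x, ⟨l, by omega, h1, h2⟩, hxg⟩

theorem derivedBall_finite (n : ℕ) : (derivedBall n).Finite :=
  ((ball_finite generators_finite _).image _).subset (derivedBall_subset n)

theorem ncard_derivedBall_le (n : ℕ) : (derivedBall n).ncard ≤ growth generators (2 * n) :=
  (Set.ncard_le_ncard (derivedBall_subset n) ((ball_finite generators_finite _).image _)).trans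
    (Set.ncard_image_le (ball_finite generators_finite _))

/-- Three elements of the commutator subgroup are the sections of an element of the commutator
subgroup that is about six times as long. -/
theorem nodeHom_mem_derivedBall {n : ℕ} {x y z : TreeAut} (hx : x ∈ derivedBall n)
    (hy : y ∈ derivedBall n) (hz : z ∈ derivedBall n) :
    nodeHom (triple x y z) ∈ derivedBall (6 * n + 4) := by
  have key : ∀ g ∈ derivedBall n, ∃ p ≤ 2 * n, ∃ q ≤ 2 * n,
      IsWord p q 0 0 (nodeHom (triple 1 1 g)) := by
    rintro g ⟨p, hp, q, hq, h⟩
    exact ⟨2 * p, by omega, p + q, by omega, by simpa using h.substitution⟩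
  obtain ⟨p, hp, q, hq, h⟩ := key x hx
  obtain ⟨p', hp', q', hq', h'⟩ := key y hy
  obtain ⟨p'', hp'', q'', hq'', h''⟩ := key z hz
  have h3 := (h.a_conj.mul h'.a_inv_conj).mul h''
  have h4 : a * (nodeHom (triple 1 1 x) * a⁻¹) * (a⁻¹ * (nodeHom (triple 1 1 y) * a)) *
      nodeHom (triple 1 1 z) = nodeHom (triple x y z) := by
    rw [← mul_assoc a, a_mul_nodeHom, mul_inv_cancel_right, ← mul_assoc a⁻¹, a_inv_mul_nodeHom,
      inv_mul_cancel_right, ← map_mul, triple_mul, ← map_mul, triple_mul]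
    simp
  rw [h4] at h3
  exact ⟨_, by omega, _, by omega, h3⟩

theorem ncard_derivedBall_pow_le (n : ℕ) :
    (derivedBall n).ncard ^ 3 ≤ (derivedBall (6 * n + 4)).ncard := by
  have hinj : Set.InjOn (fun x : TreeAut × TreeAut × TreeAut => nodeHom (triple x.1 x.2.1 x.2.2))
      (derivedBall n ×ˢ derivedBall n ×ˢ derivedBall n) := by
    rintro ⟨x, y, z⟩ - ⟨x', y', z'⟩ - h
    have := nodeHom_injective h
    have h0 : x = x' := congrFun this 0
    have h1 : y = y' := congrFun this 1
    have h2 : z = z' := congrFun this 2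
    rw [h0, h1, h2]
  have h := Set.ncard_le_ncard_of_injOn _ (t := derivedBall (6 * n + 4))
    (fun x hx => nodeHom_mem_derivedBall hx.1 hx.2.1 hx.2.2) hinj (derivedBall_finite _)
  rw [Set.ncard_prod, Set.ncard_prod] at h
  refine le_trans (le_of_eq ?_) h
  ring

theorem commutator_ne_one : a * (t * (a⁻¹ * t⁻¹)) ≠ 1 := by
  intro h
  have h1 : a * t = t * a := by
    rw [← mul_assoc, ← mul_inv_rev, mul_inv_eq_one] at h
    exact h
  have h2 := congrArg (fun g : TreeAut => g [0, 0]) h1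
  have h3 : (a * t) [0, 0] = [1, 1] := rfl
  have h4 : (t * a) [0, 0] = [1, 0] := rfl
  have h5 : ([1, 1] : Vertex) = [1, 0] := h3.symm.trans (h2.trans h4)
  simp at h5

theorem two_le_ncard_derivedBall : 2 ≤ (derivedBall 2).ncard := by
  have h1 : a * (t * (a⁻¹ * t⁻¹)) ∈ derivedBall 2 := by
    have := (((IsWord.one.t_mul false).a_mul false).t_mul true).a_mul true
    exact ⟨2, le_rfl, 2, le_rfl, by simpa [sgn] using this⟩
  have h2 : (1 : TreeAut) ∈ derivedBall 2 := ⟨0, by omega, 0, by omega, IsWord.one⟩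
  refine (Set.ncard_pair commutator_ne_one).symm.le.trans
    (Set.ncard_le_ncard ?_ (derivedBall_finite 2))
  rintro g (rfl | rfl)
  exacts [h1, h2]

theorem two_pow_le_ncard_derivedBall (k : ℕ) :
    ∃ n ≤ 3 * 6 ^ k, 2 ^ 3 ^ k ≤ (derivedBall n).ncard := by
  have key : ∃ n, n + 1 ≤ 3 * 6 ^ k ∧ 2 ^ 3 ^ k ≤ (derivedBall n).ncard := by
    induction k with
    | zero => exact ⟨2, by norm_num, by simpa using two_le_ncard_derivedBall⟩
    | succ k ih =>
      obtain ⟨n, h1, h2⟩ := ih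
      refine ⟨6 * n + 4, by rw [pow_succ]; omega, ?_⟩
      rw [pow_succ, pow_mul]
      exact (Nat.pow_le_pow_left h2 3).trans (ncard_derivedBall_pow_le n)
  obtain ⟨n, h1, h2⟩ := key
  exact ⟨n, by omega, h2⟩

theorem growth_mono : Monotone (growth generators) := by
  intro m n hmn
  refine Set.ncard_le_ncard ?_ (ball_finite generators_finite n)
  rintro g ⟨l, hl, h⟩
  exact ⟨l, hl.trans hmn, h⟩

theorem two_pow_le_growth (k : ℕ) : 2 ^ 3 ^ k ≤ growth generators (6 * 6 ^ k) := by
  obtain ⟨n, h1, h2⟩ := two_pow_le_ncard_derivedBall k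
  exact h2.trans ((ncard_derivedBall_le n).trans (growth_mono (by omega)))

theorem dominated_growth :
    Dominated (fun n : ℕ => Real.exp ((n : ℝ) ^ (Real.log 3 / Real.log 6)))
      (fun n : ℕ => (growth generators n : ℝ)) := by
  refine ⟨216, by norm_num, fun n hn => ?_⟩
  set c := Real.log 3 / Real.log 6 with hc
  have hlog6 : 0 < Real.log 6 := Real.log_pos (by norm_num)
  have hc0 : 0 < c := div_pos (Real.log_pos (by norm_num)) hlog6
  have h63 : (6 : ℝ) ^ c = 3 := by
    rw [Real.rpow_def_of_pos (by norm_num), hc, mul_div_cancel₀ _ hlog6.ne',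
      Real.exp_log (by norm_num)]
  -- Choose `j` with `6 ^ j ≤ n < 6 ^ (j + 1)`.
  set j := Nat.log 6 n with hj
  have h1 : 6 ^ j ≤ n := Nat.pow_log_le_self 6 (by omega)
  have h2 : n < 6 ^ (j + 1) := Nat.lt_pow_succ_log_self (by norm_num) n
  have h3 : (n : ℝ) ^ c ≤ 3 ^ (j + 1) := by
    calc (n : ℝ) ^ c ≤ ((6 : ℝ) ^ (j + 1)) ^ c := by
          gcongr
          exact_mod_cast h2.le
      _ = 3 ^ (j + 1) := by
          rw [← Real.rpow_natCast, ← Real.rpow_mul (by norm_num), mul_comm, Real.rpow_mul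
            (by norm_num), h63, Real.rpow_natCast]
  -- One more step replaces the base `2` by `8`, which exceeds `e`.
  have h4 : Real.exp ((n : ℝ) ^ c) ≤ ((2 ^ 3 ^ (j + 2) : ℕ) : ℝ) := by
    have h8 : Real.exp 1 ≤ 8 := by
      have := Real.exp_one_lt_d9
      linarith
    calc Real.exp ((n : ℝ) ^ c) ≤ Real.exp ((3 ^ (j + 1) : ℕ) * 1) := by
          gcongr
          push_cast
          linarith
      _ = Real.exp 1 ^ 3 ^ (j + 1) := by rw [Real.exp_nat_mul]
      _ ≤ 8 ^ 3 ^ (j + 1) := by gcongr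
      _ = _ := by
          push_cast
          rw [pow_succ 3 (j + 1), mul_comm, pow_mul]
          norm_num
  refine h4.trans ?_
  have h5 : 6 * 6 ^ (j + 2) ≤ 216 * n := by
    rw [pow_add]
    omega
  exact Nat.cast_le.2 ((two_pow_le_growth (j + 2)).trans (growth_mono h5))

theorem pow_isLittleO_growth (d : ℕ) :
    (fun n : ℕ => (n : ℝ) ^ d) =o[Filter.atTop] fun n : ℕ => (growth generators n : ℝ) := by
  obtain ⟨A, hA, hdom⟩ := dominated_growth
  set c := Real.log 3 / Real.log 6 with hc
  have hc0 : 0 < c := div_pos (Real.log_pos (by norm_num)) (Real.log_pos (by norm_num))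
  have hdiv : Filter.Tendsto (fun n : ℕ => n / A) Filter.atTop Filter.atTop :=
    Nat.tendsto_div_const_atTop hA.ne'
  have hlim : Filter.Tendsto (fun n : ℕ => ((n / A : ℕ) : ℝ) ^ c) Filter.atTop Filter.atTop :=
    (tendsto_rpow_atTop hc0).comp (tendsto_natCast_atTop_atTop.comp hdiv)
  have hexp := (isLittleO_rpow_exp_pos_mul_atTop (d / c) (b := 1) one_pos).comp_tendsto hlim
  have hlower : (fun n : ℕ => Real.exp (1 * ((n / A : ℕ) : ℝ) ^ c)) =O[Filter.atTop]
      fun n : ℕ => (growth generators n : ℝ) := by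
    refine Asymptotics.IsBigO.of_bound 1 ?_
    filter_upwards [hdiv.eventually_ge_atTop 1] with n hn
    rw [Real.norm_of_nonneg (Real.exp_pos _).le, Real.norm_of_nonneg (Nat.cast_nonneg _), one_mul,
      one_mul]
    refine (hdom (n / A) hn).trans ?_
    exact Nat.cast_le.2 (growth_mono (Nat.mul_div_le n A))
  have hupper : (fun n : ℕ => (n : ℝ) ^ d) =O[Filter.atTop]
      fun n : ℕ => (((n / A : ℕ) : ℝ) ^ c) ^ (d / c) := by
    refine Asymptotics.IsBigO.of_bound ((2 * A : ℝ) ^ d) ?_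
    filter_upwards [hdiv.eventually_ge_atTop 1] with n hn
    rw [← Real.rpow_mul (Nat.cast_nonneg _), mul_div_cancel₀ _ hc0.ne', Real.rpow_natCast,
      Real.norm_of_nonneg (by positivity), Real.norm_of_nonneg (by positivity), ← mul_pow]
    gcongr
    have h1 := Nat.lt_mul_div_succ n hA
    have h2 : n ≤ 2 * A * (n / A) := by nlinarith
    exact_mod_cast h2
  exact hupper.trans_isLittleO (hexp.trans_isBigO hlower)

end FabrykowskiGupta

theorem mainTheorem1 :
    FabrykowskiGupta.IsIntermediate
        (fun n : ℕ => (FabrykowskiGupta.growth FabrykowskiGupta.generators n : ℝ)) ∧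
      FabrykowskiGupta.Dominated
        (fun n : ℕ => Real.exp ((n : ℝ) ^ (Real.log 3 / Real.log 6)))
        (fun n : ℕ => (FabrykowskiGupta.growth FabrykowskiGupta.generators n : ℝ)) ∧
      FabrykowskiGupta.Dominated
        (fun n : ℕ => (FabrykowskiGupta.growth FabrykowskiGupta.generators n : ℝ))
        (fun n : ℕ => Real.exp ((n : ℝ) * Real.log (Real.log n) ^ 2 / Real.log n)) :=
  ⟨⟨FabrykowskiGupta.pow_isLittleO_growth, fun _ hc => FabrykowskiGupta.growth_isLittleO_pow hc⟩,
    FabrykowskiGupta.dominated_growth, FabrykowskiGupta.growth_dominated⟩
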